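/- **Setting.** Let $(\mathcal C,\otimes,I,s,a)$ be a symmetric monoidal category with a trace $\mathrm{Tr}$ (in the sense of Joyal, Street and Verity), with associator $a_{X,Y,Z}:X\otimes(Y\otimes Z)\to(X\otimes Y)\otimes Z$ and symmetry $s$. Let $N$ be an object that is *strictly self-similar*, i.e. $N\otimes N=N$ (whether or not it is a unit object). All hom-sets between objects equal to $N$ are identified with $M:=\mathcal C(N,N)$. Write $\cdot$ for composition in $\mathcal C$, $\otimes$ for the tensor on $M$, and put $\tau=a_{N,N,N}$, $\tau'=a_{N,N,N}^{-1}$, $\sigma=s_{N,N}$, all elements of $M$. *The compact closed category $\mathbf{Int}\,\mathcal C$.* Objects are pairs $(X,U)$ of objects of $\mathcal C$; arrows $(X,U)\to(Y,V)$ are arrows $X\otimes V\to Y\otimes U$ of $\mathcal C$; the composite of $f:(X,U)\to(Y,V)$ and $g:(Y,V)\to(Z,W)$ is the trace over $V$ of $X\otimes W\otimes V\cong X\otimes V\otimes W\xrightarrow{f\otimes 1}Y\otimes U\otimes W\cong Y\otimes W\otimes U\xrightarrow{g\otimes 1}Z\otimes V\otimes U\cong Z\otimes U\otimes V$. The tensor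 is $(X_1,U_1)\Box(X_2,U_2)=(X_1\otimes X_2,\,U_2\otimes U_1)$ on objects, and on arrows $f\Box g$ is $f\otimes g$ pre- and postcomposed with the evident permutations. The unit object is $(I,I)$, the dual is $(X,U)^*=(U,X)$, and the unit and co-unit are $\eta_{(X,U)}=s_{I,X\otimes U}$ and $\epsilon_{(X,U)}=s_{U\otimes X,I}$. The symmetry and associator are $s_{X,X'}\otimes s_{U,U'}$ and $a_{X,Y,Z}\otimes a_{W,V,U}$ (at $(X,U),(X',U')$ and at $(X,U),(Y,V),(Z,W)$, respectively), the inverse associator being $a^{-1}_{X,Y,Z}\otimes a^{-1}_{W,V,U}$. Since $(N,N)\Box(N,N)=(N,N)$, the endomorphisms of $(N,N)$ in $\mathbf{Int}\,\mathcal C$ also form the set $M$; write $\circ$ and $\Box$ for the composition and tensor of $\mathbf{Int}\,\mathcal C$ on $M$, and $T,T',S\in M$ for its associator at $(N,N)$, the inverse associator, and its symmetry. *The standard A-H Frobenius monoid.* An Abramsky–Heunen (A-H) Frobenius algebra at the unique object of a semi-monoidal monoid (a one-object semi-monoidal category) $(M,\circ,\Box,T)$ is a pair of a split $\Delta$ and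 a merge $\nabla$ in $M$ with $$\nabla\circ(1\Box\nabla)=\nabla\circ(\nabla\Box1)\circ T,\qquad T\circ(1\Box\Delta)\circ\Delta=(\Delta\Box1)\circ\Delta,$$ $$(1\Box\nabla)\circ T'\circ(\Delta\Box1)=\Delta\circ\nabla=(\nabla\Box1)\circ T\circ(1\Box\Delta).$$ Its A-H Frobenius monoid is the smallest subset of $M$ that contains $1,T,T',\Delta,\nabla$ and is closed under $\circ$ and $\Box$. For an object $A$ of a compact closed category, the canonical Frobenius algebra at $A^*\Box A$ has split $1_{A^*}\Box\eta_A\Box1_A$ and merge $1_{A^*}\Box\epsilon_{A^*}\Box 1_A$ (up to canonical isomorphisms, $A^{**}=A$). The *standard* A-H Frobenius algebra $(\Delta,\nabla)$ at $(N,N)$ in $\mathbf{Int}\,\mathcal C$ is the case $A=(I,N)$, transported along the canonical isomorphism $(N,I)\Box(I,N)\cong(N,N)$; the *standard A-H Frobenius monoid* at $(N,N)$ is its A-H Frobenius monoid. **Theorem.** $(M,\cdot,\otimes,\tau,\sigma)$ and $(M,\circ,\Box,T,S)$ are symmetric semi-monoidal monoids with the same identity $1=1_N$ (with $\tau'$,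 resp. $T'$, inverse to the associator), $(\Delta,\nabla)$ is an A-H Frobenius algebra in the second one, and $$\Delta=\tau\cdot(1\otimes\sigma),\qquad \nabla=(1\otimes\sigma)\cdot\tau',\qquad T=\tau\otimes\tau,\qquad T'=\tau'\otimes\tau'.$$ Consequently the standard A-H Frobenius monoid at $(N,N)$ is exactly the closure of the set $$\{\ \tau\cdot(1\otimes\sigma),\ (1\otimes\sigma)\cdot\tau',\ \tau\otimes\tau,\ \tau'\otimes\tau'\ \}$$ under the composition $\circ$ and the tensor $\Box$. -/

import Mathlib

open CategoryTheory MonoidalCategory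

/-! ### Semi-monoidal monoids and Abramsky-Heunen Frobenius algebras in them

Composition is written in the applicative order: `comp g f` is "`g` after `f`". -/

/-- `(M, comp, tens)` is a one-object symmetric semi-monoidal category (no unit object), with
associator `assoc : X ⊗ (Y ⊗ Z) ⟶ (X ⊗ Y) ⊗ Z`, its inverse `assocInv`, and symmetry `symm`. -/
structure IsSemiMonoidalMonoid {M : Type*} (comp tens : M → M → M)
    (one assoc assocInv symm : M) : Prop where
  one_comp : ∀ f, comp one f = f
  comp_one : ∀ f, comp f one = f
  comp_assoc : ∀ f g h, comp (comp f g) h = comp f (comp g h)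
  tens_one : tens one one = one
  tens_comp : ∀ f f' g g', tens (comp f f') (comp g g') = comp (tens f g) (tens f' g')
  assoc_inv : comp assoc assocInv = one
  inv_assoc : comp assocInv assoc = one
  assoc_natural : ∀ f g h,
    comp assoc (tens f (tens g h)) = comp (tens (tens f g) h) assoc
  pentagon : comp (tens assoc one) (comp assoc (tens one assoc)) = comp assoc assoc
  symm_natural : ∀ f g, comp symm (tens f g) = comp (tens g f) symm
  symm_symm : comp symm symm = one
  hexagon : comp assoc (comp symm assoc) = comp (tens symm one) (comp assoc (tens one symm))

/-- `(split, merge)` is an Abramsky-Heunen (unitless) Frobenius algebra at the unique object of a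
semi-monoidal monoid. -/
structure IsAHFrobenius {M : Type*} (comp tens : M → M → M)
    (one assoc assocInv split merge : M) : Prop where
  merge_assoc : comp merge (tens one merge) = comp merge (comp (tens merge one) assoc)
  split_coassoc : comp assoc (comp (tens one split) split) = comp (tens split one) split
  frobenius_left : comp (tens one merge) (comp assocInv (tens split one)) = comp split merge
  frobenius_right : comp (tens merge one) (comp assoc (tens one split)) = comp split merge

/-- `A` is a semi-monoidal submonoid. -/
structure IsSemiMonoidalSubmonoid {M : Type*} (comp tens : M → M → M) (one : M)
    (A : Set M) : Prop where
  one_mem : one ∈ A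
  comp_mem : ∀ f g, f ∈ A → g ∈ A → comp f g ∈ A
  tens_mem : ∀ f g, f ∈ A → g ∈ A → tens f g ∈ A

/-- The A-H Frobenius monoid of a split and a merge arrow: the smallest semi-monoidal submonoid
containing the associator, its inverse, the split arrow and the merge arrow. -/
def ahFrobeniusMonoid {M : Type*} (comp tens : M → M → M)
    (one assoc assocInv split merge : M) : Set M :=
  ⋂₀ {A | IsSemiMonoidalSubmonoid comp tens one A ∧ {assoc, assocInv, split, merge} ⊆ A}

/-- The closure of a set under two binary operations. -/
inductive OpClosure {M : Type*} (comp tens : M → M → M) (S : Set M) : M → Prop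
  | basic (f : M) (hf : f ∈ S) : OpClosure comp tens S f
  | comp (f g : M) (hf : OpClosure comp tens S f) (hg : OpClosure comp tens S g) :
      OpClosure comp tens S (comp f g)
  | tens (f g : M) (hf : OpClosure comp tens S f) (hg : OpClosure comp tens S g) :
      OpClosure comp tens S (tens f g)

/-! ### Categorical traces -/

section Trace

variable {C : Type*} [Category C] [MonoidalCategory C] [SymmetricCategory C]

/-- The canonical isomorphism `(X ⊗ Y) ⊗ Z ⟶ (X ⊗ Z) ⊗ Y` exchanging the last two factors. -/
def exchangeRight (X Y Z : C) : (X ⊗ Y) ⊗ Z ⟶ (X ⊗ Z) ⊗ Y :=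
  (α_ X Y Z).hom ≫ X ◁ (β_ Y Z).hom ≫ (α_ X Z Y).inv

variable (C) in
/-- A trace on a symmetric monoidal category, in the sense of Joyal, Street and Verity. -/
structure SymmetricTrace where
  /-- The trace `Tr^U_{X,Y}`. -/
  tr : ∀ (U : C) {X Y : C}, (X ⊗ U ⟶ Y ⊗ U) → (X ⟶ Y)
  natural_left : ∀ {U X X' Y : C} (h : X' ⟶ X) (f : X ⊗ U ⟶ Y ⊗ U),
    tr U (h ▷ U ≫ f) = h ≫ tr U f
  natural_right : ∀ {U X Y Y' : C} (f : X ⊗ U ⟶ Y ⊗ U) (k : Y ⟶ Y'),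
    tr U (f ≫ k ▷ U) = tr U f ≫ k
  dinatural : ∀ {U V X Y : C} (f : X ⊗ U ⟶ Y ⊗ V) (k : V ⟶ U),
    tr U (f ≫ Y ◁ k) = tr V (X ◁ k ≫ f)
  vanishing_one : ∀ {X Y : C} (f : X ⊗ 𝟙_ C ⟶ Y ⊗ 𝟙_ C),
    tr (𝟙_ C) f = (ρ_ X).inv ≫ f ≫ (ρ_ Y).hom
  vanishing_two : ∀ {U V X Y : C} (f : X ⊗ (U ⊗ V) ⟶ Y ⊗ (U ⊗ V)),
    tr (U ⊗ V) f = tr U (tr V ((α_ X U V).hom ≫ f ≫ (α_ Y U V).inv))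
  yanking : ∀ U : C, tr U (β_ U U).hom = 𝟙 U
  superposing : ∀ {U X Y A B : C} (f : X ⊗ U ⟶ Y ⊗ U) (g : A ⟶ B),
    tr U f ⊗ₘ g = tr U (exchangeRight X A U ≫ (f ⊗ₘ g) ≫ exchangeRight Y U B)

end Trace

/-! ### The Int construction

Composition below is in diagrammatic order: `IntHom.comp t f g` is "`f`, then `g`". -/

/-- Objects of `Int C`: pairs of objects of `C`. -/
structure IntObj (C : Type*) where
  /-- The covariant component. -/
  pos : C
  /-- The contravariant component. -/
  neg : C

section Int

variable {C : Type*} [Category C] [MonoidalCategory C]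

/-- An arrow `(X, U) ⟶ (Y, V)` of `Int C` is an arrow `X ⊗ V ⟶ Y ⊗ U` of `C`. -/
def IntHom (A B : IntObj C) := A.pos ⊗ B.neg ⟶ B.pos ⊗ A.neg

namespace IntObj

/-- `(X₁, U₁) □ (X₂, U₂) = (X₁ ⊗ X₂, U₂ ⊗ U₁)`. -/
def tensor (A B : IntObj C) : IntObj C := ⟨A.pos ⊗ B.pos, B.neg ⊗ A.neg⟩

variable (C) in
/-- The unit object `(I, I)`. -/
def unit : IntObj C := ⟨𝟙_ C, 𝟙_ C⟩

/-- The dual `(X, U)^* = (U, X)`. -/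
def dual (A : IntObj C) : IntObj C := ⟨A.neg, A.pos⟩

end IntObj

namespace IntHom

/-- The arrow `(X, U) ⟶ (Y, V)` given by `f : X ⟶ Y` and, contravariantly, `g : V ⟶ U`. -/
def ofPair {A B : IntObj C} (f : A.pos ⟶ B.pos) (g : B.neg ⟶ A.neg) : IntHom A B :=
  f ⊗ₘ g

/-- Identities. -/
def id (A : IntObj C) : IntHom A A := ofPair (𝟙 A.pos) (𝟙 A.neg)

/-- The associator `A □ (B □ D) ⟶ (A □ B) □ D`. -/
def assoc (A B D : IntObj C) : IntHom (A.tensor (B.tensor D)) ((A.tensor B).tensor D) :=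
  ofPair (α_ A.pos B.pos D.pos).inv (α_ D.neg B.neg A.neg).inv

/-- The inverse associator `(A □ B) □ D ⟶ A □ (B □ D)`. -/
def assocInv (A B D : IntObj C) : IntHom ((A.tensor B).tensor D) (A.tensor (B.tensor D)) :=
  ofPair (α_ A.pos B.pos D.pos).hom (α_ D.neg B.neg A.neg).hom

/-- The left unitor `(I, I) □ A ⟶ A`. -/
def leftUnitor (A : IntObj C) : IntHom ((IntObj.unit C).tensor A) A :=
  ofPair (λ_ A.pos).hom (ρ_ A.neg).inv

/-- The inverse left unitor `A ⟶ (I, I) □ A`. -/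
def leftUnitorInv (A : IntObj C) : IntHom A ((IntObj.unit C).tensor A) :=
  ofPair (λ_ A.pos).inv (ρ_ A.neg).hom

variable [SymmetricCategory C]

/-- Composition: for `f : X ⊗ V ⟶ Y ⊗ U` and `g : Y ⊗ W ⟶ Z ⊗ V`, trace out `V` from
`(X ⊗ W) ⊗ V ⟶ (X ⊗ V) ⊗ W ⟶ (Y ⊗ U) ⊗ W ⟶ (Y ⊗ W) ⊗ U ⟶ (Z ⊗ V) ⊗ U ⟶ (Z ⊗ U) ⊗ V`. -/
def comp (t : SymmetricTrace C) {A B D : IntObj C} (f : IntHom A B) (g : IntHom B D) :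
    IntHom A D :=
  t.tr B.neg (exchangeRight A.pos D.neg B.neg ≫
    (show A.pos ⊗ B.neg ⟶ B.pos ⊗ A.neg from f) ▷ D.neg ≫
    exchangeRight B.pos A.neg D.neg ≫
    (show B.pos ⊗ D.neg ⟶ D.pos ⊗ B.neg from g) ▷ A.neg ≫
    exchangeRight D.pos B.neg A.neg)

/-- The tensor of arrows: `f ⊗ g` between the permutations
`(X₁ ⊗ X₂) ⊗ (V₂ ⊗ V₁) ⟶ (X₁ ⊗ V₁) ⊗ (X₂ ⊗ V₂)` and
`(Y₁ ⊗ U₁) ⊗ (Y₂ ⊗ U₂) ⟶ (Y₁ ⊗ Y₂) ⊗ (U₂ ⊗ U₁)`. -/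
def tensor {A₁ B₁ A₂ B₂ : IntObj C} (f : IntHom A₁ B₁) (g : IntHom A₂ B₂) :
    IntHom (A₁.tensor A₂) (B₁.tensor B₂) :=
  (A₁.pos ⊗ A₂.pos) ◁ (β_ B₂.neg B₁.neg).hom ≫
    tensorμ A₁.pos A₂.pos B₁.neg B₂.neg ≫
    ((show A₁.pos ⊗ B₁.neg ⟶ B₁.pos ⊗ A₁.neg from f) ⊗ₘ
      (show A₂.pos ⊗ B₂.neg ⟶ B₂.pos ⊗ A₂.neg from g)) ≫
    tensorμ B₁.pos A₁.neg B₂.pos A₂.neg ≫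
    (B₁.pos ⊗ B₂.pos) ◁ (β_ A₁.neg A₂.neg).hom

/-- The symmetry `A □ B ⟶ B □ A`. -/
def symm (A B : IntObj C) : IntHom (A.tensor B) (B.tensor A) :=
  ofPair (β_ A.pos B.pos).hom (β_ A.neg B.neg).hom

/-- The unit `η_A : (I, I) ⟶ A □ A^*` of the compact closed structure. -/
def eta (A : IntObj C) : IntHom (IntObj.unit C) (A.tensor A.dual) :=
  (β_ (𝟙_ C) (A.pos ⊗ A.neg)).hom

/-- The co-unit `ε_A : A^* □ A ⟶ (I, I)` of the compact closed structure. -/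
def epsilon (A : IntObj C) : IntHom (A.dual.tensor A) (IntObj.unit C) :=
  (β_ (A.neg ⊗ A.pos) (𝟙_ C)).hom

/-- The split arrow of the canonical Frobenius algebra at `A^* □ A`:
`A^* □ A ≅ A^* □ (I □ A) ⟶ A^* □ ((A □ A^*) □ A) ≅ (A^* □ A) □ (A^* □ A)`,
the middle arrow being `1 □ (η_A □ 1)`. -/
def canonicalSplit (t : SymmetricTrace C) (A : IntObj C) :
    IntHom (A.dual.tensor A) ((A.dual.tensor A).tensor (A.dual.tensor A)) :=
  comp t (tensor (id A.dual) (leftUnitorInv A)) <|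
  comp t (tensor (id A.dual) (tensor (eta A) (id A))) <|
  comp t (tensor (id A.dual) (assocInv A A.dual A)) <|
  assoc A.dual A (A.dual.tensor A)

/-- The merge arrow of the canonical Frobenius algebra at `A^* □ A`:
`(A^* □ A) □ (A^* □ A) ≅ A^* □ ((A □ A^*) □ A) ⟶ A^* □ (I □ A) ≅ A^* □ A`,
the middle arrow being `1 □ (ε □ 1)` with the co-unit `ε_{A^*} : A □ A^* ⟶ (I, I)`
(note that `A^** = A`). -/
def canonicalMerge (t : SymmetricTrace C) (A : IntObj C) :
    IntHom ((A.dual.tensor A).tensor (A.dual.tensor A)) (A.dual.tensor A) :=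
  comp t (assocInv A.dual A (A.dual.tensor A)) <|
  comp t (tensor (id A.dual) (assoc A A.dual A)) <|
  comp t (tensor (id A.dual) (tensor (epsilon A.dual) (id A))) <|
  tensor (id A.dual) (leftUnitor A)

/-- The canonical isomorphism `A^* □ A ⟶ (N, N)` for `A = (I, N)`, `A^* = (N, I)`. -/
def fold (N : C) : IntHom ((IntObj.mk (𝟙_ C) N).dual.tensor ⟨𝟙_ C, N⟩) ⟨N, N⟩ :=
  ofPair (ρ_ N).hom (ρ_ N).inv

/-- The inverse `(N, N) ⟶ A^* □ A` of the canonical isomorphism. -/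
def unfold (N : C) : IntHom ⟨N, N⟩ ((IntObj.mk (𝟙_ C) N).dual.tensor ⟨𝟙_ C, N⟩) :=
  ofPair (ρ_ N).inv (ρ_ N).hom

/-- The split arrow of the standard A-H Frobenius algebra at `(N, N)`: the canonical one,
transported along `(N, N) ≅ (N, I) □ (I, N)`. -/
def standardSplit (t : SymmetricTrace C) (N : C) :
    IntHom ⟨N, N⟩ (IntObj.tensor ⟨N, N⟩ ⟨N, N⟩) :=
  comp t (unfold N) (comp t (canonicalSplit t ⟨𝟙_ C, N⟩) (tensor (fold N) (fold N)))

/-- The merge arrow of the standard A-H Frobenius algebra at `(N, N)`. -/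
def standardMerge (t : SymmetricTrace C) (N : C) :
    IntHom (IntObj.tensor ⟨N, N⟩ ⟨N, N⟩) ⟨N, N⟩ :=
  comp t (tensor (unfold N) (unfold N)) (comp t (canonicalMerge t ⟨𝟙_ C, N⟩) (fold N))

end IntHom

end Int

/-! ### The two semi-monoidal structures on the endomorphisms of a strictly self-similar object

Throughout `h : N ⊗ N = N`, and hom-sets between objects equal to `N` are identified with
`M = (N ⟶ N)`. -/

namespace StrictSelfSimilar

section Traced

variable {C : Type*} [Category C]

/-- The identification of `A ⟶ B` with `N ⟶ N` when `A = N` and `B = N`. -/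
def endCast {N A B : C} (hA : A = N) (hB : B = N) (f : A ⟶ B) : N ⟶ N :=
  eqToHom hA.symm ≫ f ≫ eqToHom hB

/-- Composition of `C` in applicative order. -/
def dot {N : C} (g f : N ⟶ N) : N ⟶ N := f ≫ g

variable [MonoidalCategory C] {N : C} (h : N ⊗ N = N)

theorem tensor_right_eq (h : N ⊗ N = N) : N ⊗ (N ⊗ N) = N := by rw [h, h]

theorem tensor_left_eq (h : N ⊗ N = N) : (N ⊗ N) ⊗ N = N := by rw [h, h]

/-- The tensor of `C` on `M`. -/
def tens (f g : N ⟶ N) : N ⟶ N := endCast h h (f ⊗ₘ g)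

/-- The associator `N ⊗ (N ⊗ N) ⟶ (N ⊗ N) ⊗ N` of `C`, in `M`. -/
def tau : N ⟶ N := endCast (tensor_right_eq h) (tensor_left_eq h) (α_ N N N).inv

/-- The inverse associator of `C`, in `M`. -/
def tauInv : N ⟶ N := endCast (tensor_left_eq h) (tensor_right_eq h) (α_ N N N).hom

/-- The symmetry of `C`, in `M`. -/
def sigma [SymmetricCategory C] : N ⟶ N := endCast h h (β_ N N).hom

end Traced

section Int

variable {C : Type*} [Category C] [MonoidalCategory C] {N : C} (h : N ⊗ N = N)

theorem intTensor_eq (h : N ⊗ N = N) : IntObj.tensor ⟨N, N⟩ ⟨N, N⟩ = (⟨N, N⟩ : IntObj C) := by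
  simp only [IntObj.tensor, h]

theorem intTensor_right_eq (h : N ⊗ N = N) :
    IntObj.tensor ⟨N, N⟩ (IntObj.tensor ⟨N, N⟩ ⟨N, N⟩) = (⟨N, N⟩ : IntObj C) := by
  rw [intTensor_eq h, intTensor_eq h]

theorem intTensor_left_eq (h : N ⊗ N = N) :
    IntObj.tensor (IntObj.tensor ⟨N, N⟩ ⟨N, N⟩) ⟨N, N⟩ = (⟨N, N⟩ : IntObj C) := by
  rw [intTensor_eq h, intTensor_eq h]

theorem pos_tensor_neg_eq (h : N ⊗ N = N) {A B : IntObj C} (hA : A = ⟨N, N⟩) (hB : B = ⟨N, N⟩) :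
    A.pos ⊗ B.neg = N := by rw [hA, hB]; exact h

/-- The identification of `Int C (A, B)` with `M` when `A = (N, N)` and `B = (N, N)`. -/
def intCast {A B : IntObj C} (hA : A = ⟨N, N⟩) (hB : B = ⟨N, N⟩) (f : IntHom A B) : N ⟶ N :=
  endCast (pos_tensor_neg_eq h hA hB) (pos_tensor_neg_eq h hB hA) f

/-- An element of `M`, as an endomorphism of `(N, N)` in `Int C`. -/
def toInt (f : N ⟶ N) : IntHom (⟨N, N⟩ : IntObj C) ⟨N, N⟩ :=
  eqToHom h ≫ f ≫ eqToHom h.symm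

/-- The associator of `Int C` at `(N, N)`, in `M`. -/
def intAssoc : N ⟶ N :=
  intCast h (intTensor_right_eq h) (intTensor_left_eq h) (IntHom.assoc ⟨N, N⟩ ⟨N, N⟩ ⟨N, N⟩)

/-- The inverse associator of `Int C` at `(N, N)`, in `M`. -/
def intAssocInv : N ⟶ N :=
  intCast h (intTensor_left_eq h) (intTensor_right_eq h) (IntHom.assocInv ⟨N, N⟩ ⟨N, N⟩ ⟨N, N⟩)

variable [SymmetricCategory C] (t : SymmetricTrace C)

/-- The composition `g ∘ f` of `Int C` on `M`, in applicative order. -/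
def circ (g f : N ⟶ N) : N ⟶ N :=
  intCast h rfl rfl (IntHom.comp t (toInt h f) (toInt h g))

/-- The tensor of `Int C` on `M`. -/
def box (f g : N ⟶ N) : N ⟶ N :=
  intCast h (intTensor_eq h) (intTensor_eq h) (IntHom.tensor (toInt h f) (toInt h g))

/-- The symmetry of `Int C` at `(N, N)`, in `M`. -/
def intSymm : N ⟶ N :=
  intCast h (intTensor_eq h) (intTensor_eq h) (IntHom.symm ⟨N, N⟩ ⟨N, N⟩)

/-- The split arrow of the standard A-H Frobenius algebra at `(N, N)`, in `M`. -/
def split : N ⟶ N := intCast h rfl (intTensor_eq h) (IntHom.standardSplit t N)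

/-- The merge arrow of the standard A-H Frobenius algebra at `(N, N)`, in `M`. -/
def merge : N ⟶ N := intCast h (intTensor_eq h) rfl (IntHom.standardMerge t N)

/-- The standard A-H Frobenius monoid at `(N, N)`. -/
def standardAHFrobeniusMonoid : Set (N ⟶ N) :=
  ahFrobeniusMonoid (circ h t) (box h) (𝟙 N) (intAssoc h) (intAssocInv h) (split h t) (merge h t)

end Int

end StrictSelfSimilar

open StrictSelfSimilar

/-! ### Coherence for symmetric monoidal categories -/

section Coherence

variable {C : Type*} [Category C] [MonoidalCategory C]

/-! Composing in `Int C` with an arrow given by a pair of arrows of `C` needs no trace: naturality,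
dinaturality and yanking reduce it to plain pre- and postcomposition (`IntHom.ofPair_comp`,
`IntHom.comp_ofPair`). The associators, the unitors and the isomorphism $(N,I)\Box(I,N)\cong(N,N)$
are pairs, and the standard split and merge each contain just one other factor, the one with $\eta$
or $\epsilon$. So their formulas become equations between permutations of three copies of $N$
(`standardSplit_eq`, `standardMerge_eq`).

The Frobenius laws hold in any monoidal category for the algebra at $P\otimes Q$ built from
arbitrary arrows $I\to Q\otimes P$ and $Q\otimes P\to I$; only interchange is needed. It thus
suffices that `Int C` is monoidal, the two real points being associativity of composition
(`IntHom.comp_assoc`) and functoriality of the tensor (`IntHom.tensor_comp`).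

Equations between permutations are checked with generalised elements. For a list of objects, a
`Grading` gives an object for each set of positions and a commutative multiplication of disjoint
sets. An element of $A$ is a set of arrows from $A$ to these objects. Taking sets makes the product
total (possibly empty) and avoids comparing types indexed by differently bracketed unions. Structure
arrows merely rearrange products of elements, and a product of distinct atoms is one invertible
arrow, so two arrows that pull it back alike are equal (`Sharp.eq_of_pre_eq`).

The strict equality $N\otimes N=N$ enters only at the end, where typed equations in `C` and `Int C`
are transported to $M$ by casts. -/

theorem braiding_tensorμ [SymmetricCategory C] (X₁ X₂ Y₁ Y₂ : C) :
    (β_ (X₁ ⊗ X₂) (Y₁ ⊗ Y₂)).hom ≫ tensorμ Y₁ Y₂ X₁ X₂ =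
      tensorμ X₁ X₂ Y₁ Y₂ ≫ ((β_ X₁ Y₁).hom ⊗ₘ (β_ X₂ Y₂).hom) := by
  simp [tensorμ, BraidedCategory.braiding_tensor_left_hom,
    BraidedCategory.braiding_tensor_right_hom, MonoidalCategory.tensorHom_def]
  calc
    _ = 𝟙 _ ⊗≫ X₁ ◁ (β_ X₂ Y₁).hom ▷ Y₂ ⊗≫
        ((β_ X₁ Y₁).hom ▷ (X₂ ⊗ Y₂) ≫ (Y₁ ⊗ X₁) ◁ (β_ X₂ Y₂).hom) ⊗≫
        Y₁ ◁ ((β_ X₁ Y₂).hom ≫ (β_ Y₂ X₁).hom) ▷ X₂ ⊗≫ 𝟙 _ := by monoidal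
    -- The strand `X₁` crosses `Y₂` and crosses back; this double crossing is trivial because the
    -- braiding is a symmetry.
    _ = _ := by rw [SymmetricCategory.symmetry]; monoidal

variable (C) in
/-- A partial commutative monoid `S` with a lax symmetric monoidal family of objects indexed by it,
all of whose structure arrows are invertible. -/
structure Grading [SymmetricCategory C] where
  /-- The indices. -/
  S : Type
  /-- The object of an index. -/
  obj : S → C
  /-- The multiplication of indices. -/
  join : S → S → S
  /-- The domain of definition of the multiplication. -/
  disj : S → S → Bool
  /-- The neutral index. -/
  zero : S
  zero_join : ∀ s, join zero s = s
  join_comm : ∀ s t, join s t = join t s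
  join_assoc : ∀ s t u, join (join s t) u = join s (join t u)
  zero_disj : ∀ s, disj zero s = true
  disj_comm : ∀ s t, disj s t = disj t s
  disj_assoc : ∀ s t u, (disj s t && disj (join s t) u) = (disj t u && disj s (join t u))
  /-- The unit arrow. -/
  unit : 𝟙_ C ⟶ obj zero
  /-- The multiplication arrows. -/
  merge : ∀ {s t r : S}, disj s t = true → join s t = r → (obj s ⊗ obj t ⟶ obj r)
  isIso_unit : IsIso unit
  isIso_merge : ∀ {s t r : S} (hd : disj s t = true) (hr : join s t = r), IsIso (merge hd hr)
  unit_merge : ∀ s, unit ▷ obj s ≫ merge (zero_disj s) (zero_join s) = (λ_ (obj s)).hom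
  braiding_merge : ∀ {s t r : S} (hd : disj s t = true) (hr : join s t = r)
    (hd' : disj t s = true) (hr' : join t s = r),
    (β_ (obj s) (obj t)).hom ≫ merge hd' hr' = merge hd hr
  merge_assoc : ∀ {s t u p q r : S} (hd₁ : disj s t = true) (hp : join s t = p)
    (hd₂ : disj p u = true) (hr₁ : join p u = r) (hd₃ : disj t u = true) (hq : join t u = q)
    (hd₄ : disj s q = true) (hr₂ : join s q = r),
    merge hd₁ hp ▷ obj u ≫ merge hd₂ hr₁ =
      (α_ (obj s) (obj t) (obj u)).hom ≫ obj s ◁ merge hd₃ hq ≫ merge hd₄ hr₂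

/-! ### Gradings by the subsets of a list of objects -/

namespace Grading

variable [SymmetricCategory C]

variable (C) in
/-- The grading by the one-element monoid. -/
def trivial : Grading C where
  S := Unit
  obj _ := 𝟙_ C
  join _ _ := ()
  disj _ _ := true
  zero := ()
  zero_join _ := rfl
  join_comm _ _ := rfl
  join_assoc _ _ _ := rfl
  zero_disj _ := rfl
  disj_comm _ _ := rfl
  disj_assoc _ _ _ := rfl
  unit := 𝟙 _
  merge _ _ := (λ_ _).hom
  isIso_unit := inferInstance
  isIso_merge _ _ := inferInstance
  unit_merge _ := by simp
  braiding_merge _ _ _ _ := by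
    rw [braiding_leftUnitor, unitors_equal]
  merge_assoc _ _ _ _ _ _ _ _ := by monoidal

/-- The objects of `single X`. -/
def powBool (X : C) : Bool → C
  | false => 𝟙_ C
  | true => X

/-- The multiplication of `single X`. -/
def mergeBool (X : C) : ∀ {s t r : Bool}, (!(s && t)) = true → (s || t) = r →
    (powBool X s ⊗ powBool X t ⟶ powBool X r)
  | false, _, _, _, rfl => (λ_ _).hom
  | true, false, _, _, rfl => (ρ_ _).hom

/-- The grading in which the object `X` may occur at most once. -/
def single (X : C) : Grading C where
  S := Bool
  obj := powBool X
  join := or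
  -- Two copies of `X` must not be multiplied: commutativity of an invertible multiplication would
  -- force `β_ X X` to be the identity.
  disj s t := !(s && t)
  zero := false
  zero_join := by decide
  join_comm := by decide
  join_assoc := by decide
  zero_disj := by decide
  disj_comm := by decide
  disj_assoc := by decide
  unit := 𝟙 _
  merge := mergeBool X
  isIso_unit := inferInstanceAs (IsIso (𝟙 (𝟙_ C)))
  isIso_merge {s t r} hd hr := by
    subst hr
    cases s
    · exact inferInstanceAs (IsIso (λ_ (powBool X t)).hom)
    · cases t
      · exact inferInstanceAs (IsIso (ρ_ X).hom)
      · simp at hd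
  unit_merge s := by simp [mergeBool, powBool]
  braiding_merge {s t r} hd hr _ _ := by
    subst hr
    cases s <;> cases t
    · exact (braiding_leftUnitor (𝟙_ C)).trans unitors_equal.symm
    · exact braiding_rightUnitor X
    · exact braiding_leftUnitor X
    · simp at hd
  merge_assoc {s t u p q r} hd₁ hp hd₂ hr₁ hd₃ hq hd₄ hr₂ := by
    subst hp hq hr₁
    cases s
    · exact (by monoidal : (λ_ (powBool X t)).hom ▷ powBool X u ≫ mergeBool X hd₂ rfl =
        (α_ (𝟙_ C) (powBool X t) (powBool X u)).hom ≫ 𝟙_ C ◁ mergeBool X hd₃ rfl ≫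
          (λ_ (powBool X (t || u))).hom)
    · cases t
      · cases u
        · exact (by monoidal : (ρ_ X).hom ▷ 𝟙_ C ≫ (ρ_ X).hom =
            (α_ X (𝟙_ C) (𝟙_ C)).hom ≫ X ◁ (λ_ (𝟙_ C)).hom ≫ (ρ_ X).hom)
        · simp at hd₄
      · simp at hd₁

/-- The product of two gradings. -/
def prod (G H : Grading C) : Grading C where
  S := G.S × H.S
  obj s := G.obj s.1 ⊗ H.obj s.2
  join s t := (G.join s.1 t.1, H.join s.2 t.2)
  disj s t := G.disj s.1 t.1 && H.disj s.2 t.2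
  zero := (G.zero, H.zero)
  zero_join s := by simp [G.zero_join, H.zero_join]
  join_comm s t := by rw [G.join_comm, H.join_comm]
  join_assoc s t u := by simp [G.join_assoc, H.join_assoc]
  zero_disj s := by simp [G.zero_disj, H.zero_disj]
  disj_comm s t := by rw [G.disj_comm, H.disj_comm]
  disj_assoc s t u := by
    have := G.disj_assoc s.1 t.1 u.1
    have := H.disj_assoc s.2 t.2 u.2
    grind
  unit := (λ_ (𝟙_ C)).inv ≫ (G.unit ⊗ₘ H.unit)
  merge {s t r} hd hr := tensorμ _ _ _ _ ≫
    (G.merge (by simp at hd; exact hd.1) (congrArg Prod.fst hr) ⊗ₘ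
      H.merge (by simp at hd; exact hd.2) (congrArg Prod.snd hr))
  isIso_unit := by
    have := G.isIso_unit
    have := H.isIso_unit
    infer_instance
  isIso_merge {s t r} hd hr := by
    simp at hd
    have := G.isIso_merge hd.1 (congrArg Prod.fst hr)
    have := H.isIso_merge hd.2 (congrArg Prod.snd hr)
    have : IsIso (tensorμ (G.obj s.1) (H.obj s.2) (G.obj t.1) (H.obj t.2)) :=
      ⟨tensorδ _ _ _ _, tensorμ_tensorδ _ _ _ _, tensorδ_tensorμ _ _ _ _⟩
    infer_instance
  unit_merge s := by
    rw [tensor_left_unitality, comp_whiskerRight, Category.assoc, tensorμ_natural_left_assoc,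
      tensorHom_comp_tensorHom, G.unit_merge, H.unit_merge]
  braiding_merge {s t r} hd hr hd' hr' := by
    simp at hd hd'
    rw [← Category.assoc, braiding_tensorμ, Category.assoc, tensorHom_comp_tensorHom,
      G.braiding_merge hd.1 (congrArg Prod.fst hr), H.braiding_merge hd.2 (congrArg Prod.snd hr)]
  merge_assoc {s t u p q r} hd₁ hp hd₂ hr₁ hd₃ hq hd₄ hr₂ := by
    simp at hd₁ hd₂ hd₃ hd₄
    rw [comp_whiskerRight, Category.assoc, tensorμ_natural_left_assoc, tensorHom_comp_tensorHom,
      G.merge_assoc hd₁.1 (congrArg Prod.fst hp) hd₂.1 (congrArg Prod.fst hr₁) hd₃.1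
        (congrArg Prod.fst hq) hd₄.1 (congrArg Prod.fst hr₂),
      H.merge_assoc hd₁.2 (congrArg Prod.snd hp) hd₂.2 (congrArg Prod.snd hr₁) hd₃.2
        (congrArg Prod.snd hq) hd₄.2 (congrArg Prod.snd hr₂),
      ← tensorHom_comp_tensorHom, tensor_associativity_assoc, ← tensorHom_comp_tensorHom,
      MonoidalCategory.whiskerLeft_comp, Category.assoc, tensorμ_natural_right_assoc]

/-- The grading in which each member of a list of objects may occur at most once. -/
def ofList : List C → Grading C
  | [] => trivial C
  | X :: l => (single X).prod (ofList l)

/-- The index of a member of a list. -/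
def idx : ∀ (l : List C), Fin l.length → (ofList l).S
  | X :: l, i => Fin.cases (motive := fun _ => (ofList (X :: l)).S)
      (true, (ofList l).zero) (fun j => (false, idx l j)) i

/-- Extends `merge_assoc` to arbitrary arrows in the three slots; both inclusions of
`Pt.pre_associator_inv` rest on it. -/
theorem tensorHom_merge_assoc (G : Grading C) {A B D : C} {s t u p q r : G.S}
    (φ : A ⟶ G.obj s) (ψ : B ⟶ G.obj t) (χ : D ⟶ G.obj u)
    (hd₁ : G.disj s t = true) (hp : G.join s t = p)
    (hd₂ : G.disj p u = true) (hr₁ : G.join p u = r) (hd₃ : G.disj t u = true)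
    (hq : G.join t u = q) (hd₄ : G.disj s q = true) (hr₂ : G.join s q = r) :
    ((φ ⊗ₘ ψ) ≫ G.merge hd₁ hp ⊗ₘ χ) ≫ G.merge hd₂ hr₁ =
      (α_ A B D).hom ≫ (φ ⊗ₘ (ψ ⊗ₘ χ) ≫ G.merge hd₃ hq) ≫ G.merge hd₄ hr₂ := by
  have h₁ : ((φ ⊗ₘ ψ) ≫ G.merge hd₁ hp ⊗ₘ χ) =
      ((φ ⊗ₘ ψ) ⊗ₘ χ) ≫ G.merge hd₁ hp ▷ G.obj u := by
    rw [← tensorHom_id, tensorHom_comp_tensorHom, Category.comp_id]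
  have h₂ : (φ ⊗ₘ (ψ ⊗ₘ χ) ≫ G.merge hd₃ hq) =
      (φ ⊗ₘ (ψ ⊗ₘ χ)) ≫ G.obj s ◁ G.merge hd₃ hq := by
    rw [← id_tensorHom, tensorHom_comp_tensorHom, Category.comp_id]
  rw [h₁, h₂, Category.assoc, Category.assoc, G.merge_assoc hd₁ hp hd₂ hr₁ hd₃ hq hd₄ hr₂,
    associator_naturality_assoc]

/-- Sets of arrows from `A` to the objects of a grading. -/
def Pt (G : Grading C) (A : C) := ∀ s : G.S, (A ⟶ G.obj s) → Prop

/-! ### Generalised elements and the action of structure arrows on them -/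

namespace Pt

variable {G : Grading C}

/-- The set consisting of one arrow. -/
def singleton {A : C} {s : G.S} (φ : A ⟶ G.obj s) : Pt G A :=
  fun t ψ => (⟨t, ψ⟩ : Σ t : G.S, A ⟶ G.obj t) = ⟨s, φ⟩

/-- Precomposition. -/
def pre {A B : C} (f : A ⟶ B) (Φ : Pt G B) : Pt G A :=
  fun s χ => ∃ φ, Φ s φ ∧ χ = f ≫ φ

variable (G) in
/-- The unit. -/
def one : Pt G (𝟙_ C) := singleton G.unit

/-- The product. -/
def tens {A B : C} (Φ : Pt G A) (Ψ : Pt G B) : Pt G (A ⊗ B) :=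
  fun r χ => ∃ s t φ ψ, Φ s φ ∧ Ψ t ψ ∧
    ∃ (hd : G.disj s t = true) (hr : G.join s t = r), χ = (φ ⊗ₘ ψ) ≫ G.merge hd hr

@[ext]
theorem ext {A : C} {Φ Ψ : Pt G A} (h : ∀ s φ, Φ s φ ↔ Ψ s φ) : Φ = Ψ :=
  funext fun s => funext fun φ => propext (h s φ)

theorem pre_id {A : C} (Φ : Pt G A) : pre (𝟙 A) Φ = Φ := by
  ext s φ
  exact ⟨fun ⟨ψ, h, e⟩ => by simp at e; subst e; exact h, fun h => ⟨φ, h, by simp⟩⟩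

theorem pre_comp {A B D : C} (f : A ⟶ B) (g : B ⟶ D) (Φ : Pt G D) :
    pre (f ≫ g) Φ = pre f (pre g Φ) := by
  ext s φ
  constructor
  · rintro ⟨ψ, h, e⟩
    exact ⟨g ≫ ψ, ⟨ψ, h, rfl⟩, by simpa using e⟩
  · rintro ⟨_, ⟨ψ, h, rfl⟩, e⟩
    exact ⟨ψ, h, by simpa using e⟩

theorem pre_tensorHom {A B A' B' : C} (f : A ⟶ A') (g : B ⟶ B') (Φ : Pt G A') (Ψ : Pt G B') :
    pre (f ⊗ₘ g) (tens Φ Ψ) = tens (pre f Φ) (pre g Ψ) := by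
  ext r χ
  constructor
  · rintro ⟨_, ⟨s, t, φ, ψ, hφ, hψ, hd, hr, rfl⟩, e⟩
    exact ⟨s, t, f ≫ φ, g ≫ ψ, ⟨φ, hφ, rfl⟩, ⟨ψ, hψ, rfl⟩, hd, hr, by
      simpa [tensorHom_comp_tensorHom_assoc] using e⟩
  · rintro ⟨s, t, _, _, ⟨φ, hφ, rfl⟩, ⟨ψ, hψ, rfl⟩, hd, hr, e⟩
    exact ⟨_, ⟨s, t, φ, ψ, hφ, hψ, hd, hr, rfl⟩, by
      simpa [tensorHom_comp_tensorHom_assoc] using e⟩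

theorem pre_whiskerRight {A B A' : C} (f : A ⟶ A') (Φ : Pt G A') (Ψ : Pt G B) :
    pre (f ▷ B) (tens Φ Ψ) = tens (pre f Φ) Ψ := by
  rw [← tensorHom_id, pre_tensorHom, pre_id]

theorem pre_whiskerLeft {A B B' : C} (g : B ⟶ B') (Φ : Pt G A) (Ψ : Pt G B') :
    pre (A ◁ g) (tens Φ Ψ) = tens Φ (pre g Ψ) := by
  rw [← id_tensorHom, pre_tensorHom, pre_id]

theorem pre_iso_iff {A B : C} (f : A ≅ B) (Φ : Pt G B) (Ψ : Pt G A) :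
    pre f.hom Φ = Ψ ↔ pre f.inv Ψ = Φ := by
  constructor <;> rintro rfl <;> simp [← pre_comp, pre_id]

/-- Commutativity of the multiplication gives one inclusion; the braiding being involutive, the
other is the same inclusion with the factors exchanged. -/
theorem pre_braiding {A B : C} (Φ : Pt G A) (Ψ : Pt G B) :
    pre (β_ B A).hom (tens Φ Ψ) = tens Ψ Φ := by
  have key : ∀ {A B : C} (Φ : Pt G A) (Ψ : Pt G B) r χ, pre (β_ B A).hom (tens Φ Ψ) r χ →
      tens Ψ Φ r χ := by
    rintro A B Φ Ψ r χ ⟨_, ⟨s, t, φ, ψ, hφ, hψ, hd, hr, rfl⟩, e⟩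
    have hd' := (G.disj_comm t s).trans hd
    have hr' := (G.join_comm t s).trans hr
    refine ⟨t, s, ψ, φ, hψ, hφ, hd', hr', e.trans ?_⟩
    rw [← BraidedCategory.braiding_naturality_assoc, G.braiding_merge hd' hr']
  ext r ω
  refine ⟨key Φ Ψ r ω, fun hz => ?_⟩
  rw [← pre_id (tens Ψ Φ), ← SymmetricCategory.symmetry, pre_comp] at hz
  obtain ⟨χ, hχ, e⟩ := hz
  exact ⟨χ, key _ _ _ _ hχ, e⟩

theorem pre_associator_inv {A B D : C} (Φ : Pt G A) (Ψ : Pt G B) (Χ : Pt G D) :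
    pre (α_ A B D).inv (tens (tens Φ Ψ) Χ) = tens Φ (tens Ψ Χ) := by
  ext r ω
  constructor
  · rintro ⟨_, ⟨p, u, _, χ, ⟨s, t, φ, ψ, hφ, hψ, hd₁, hp, rfl⟩, hχ, hd₂, hr₁, rfl⟩, e⟩
    have := G.disj_assoc s t u
    have := G.join_assoc s t u
    refine ⟨s, G.join t u, φ, (ψ ⊗ₘ χ) ≫ G.merge (by grind) rfl, hφ,
      ⟨t, u, ψ, χ, hψ, hχ, by grind, rfl, rfl⟩, by grind, by grind, e.trans ?_⟩
    rw [Iso.inv_comp_eq]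
    exact G.tensorHom_merge_assoc _ _ _ hd₁ hp hd₂ hr₁ _ _ _ _
  · rintro ⟨s, q, φ, _, hφ, ⟨t, u, ψ, χ, hψ, hχ, hd₁, hp, rfl⟩, hd₂, hr₁, e⟩
    have := G.disj_assoc s t u
    have := G.join_assoc s t u
    refine ⟨_, ⟨G.join s t, u, (φ ⊗ₘ ψ) ≫ G.merge (by grind) rfl, χ,
      ⟨s, t, φ, ψ, hφ, hψ, by grind, rfl, rfl⟩, hχ, by grind, by grind, rfl⟩, e.trans ?_⟩
    rw [Iso.eq_inv_comp]
    exact (G.tensorHom_merge_assoc _ _ _ _ _ _ _ hd₁ hp hd₂ hr₁).symm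

theorem pre_associator_hom {A B D : C} (Φ : Pt G A) (Ψ : Pt G B) (Χ : Pt G D) :
    pre (α_ A B D).hom (tens Φ (tens Ψ Χ)) = tens (tens Φ Ψ) Χ := by
  rw [pre_iso_iff, pre_associator_inv]

theorem pre_leftUnitor_hom {A : C} (Φ : Pt G A) : pre (λ_ A).hom Φ = tens (one G) Φ := by
  ext s χ
  constructor
  · rintro ⟨φ, hφ, e⟩
    refine ⟨G.zero, s, G.unit, φ, rfl, hφ, G.zero_disj s, G.zero_join s, ?_⟩
    rw [tensorHom_def', Category.assoc, G.unit_merge]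
    simpa using e
  · rintro ⟨_, t, _, φ, h, hφ, hd, hr, e⟩
    cases h
    obtain rfl := (G.zero_join t).symm.trans hr
    refine ⟨φ, hφ, ?_⟩
    rw [tensorHom_def', Category.assoc, G.unit_merge] at e
    simpa using e

theorem pre_leftUnitor_inv {A : C} (Φ : Pt G A) : pre (λ_ A).inv (tens (one G) Φ) = Φ := by
  rw [← pre_iso_iff, pre_leftUnitor_hom]

theorem pre_rightUnitor_hom {A : C} (Φ : Pt G A) : pre (ρ_ A).hom Φ = tens Φ (one G) := by
  rw [← braiding_leftUnitor, pre_comp, pre_leftUnitor_hom, pre_braiding]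

theorem pre_rightUnitor_inv {A : C} (Φ : Pt G A) : pre (ρ_ A).inv (tens Φ (one G)) = Φ := by
  rw [← pre_iso_iff, pre_rightUnitor_hom]

theorem pre_tensorμ {A A' B B' : C} (a : Pt G A) (a' : Pt G A') (b : Pt G B) (b' : Pt G B') :
    pre (tensorμ A B A' B') (tens (tens a a') (tens b b')) = tens (tens a b) (tens a' b') := by
  simp only [tensorμ, pre_comp, pre_associator_inv, pre_associator_hom, pre_whiskerLeft,
    pre_whiskerRight, pre_braiding]

theorem pre_exchangeRight {A B D : C} (a : Pt G A) (b : Pt G B) (d : Pt G D) :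
    pre (exchangeRight A B D) (tens (tens a d) b) = tens (tens a b) d := by
  simp only [exchangeRight, pre_comp, pre_associator_inv, pre_associator_hom, pre_whiskerLeft,
    pre_braiding]

/-- A set consisting of one invertible arrow, of a given index. -/
def Sharp {A : C} (Φ : Pt G A) (s : G.S) : Prop :=
  ∃ φ : A ⟶ G.obj s, IsIso φ ∧ Φ = singleton φ

/-- The two pullbacks consist of `f ≫ φ` and of `g ≫ φ` alone, and the isomorphism `φ` cancels. This
reduces a coherence equation to a computation with formal products. -/
theorem Sharp.eq_of_pre_eq {A B : C} {f g : A ⟶ B} {Φ : Pt G B} {s : G.S} (hΦ : Sharp Φ s)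
    (h : pre f Φ = pre g Φ) : f = g := by
  obtain ⟨φ, hφ, rfl⟩ := hΦ
  have : pre f (singleton φ) s (f ≫ φ) := ⟨φ, rfl, rfl⟩
  rw [h] at this
  obtain ⟨φ', h', e⟩ := this
  cases h'
  exact (cancel_mono φ).1 e

theorem sharp_one : Sharp (one G) G.zero := ⟨_, G.isIso_unit, rfl⟩

/-- Without disjointness the product would be empty; with it exactly one arrow remains, a composite
of isomorphisms. -/
theorem Sharp.tens {A B : C} {Φ : Pt G A} {Ψ : Pt G B} {s t : G.S} (hΦ : Sharp Φ s)
    (hΨ : Sharp Ψ t) (hd : G.disj s t = true) : Sharp (tens Φ Ψ) (G.join s t) := by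
  obtain ⟨φ, hφ, rfl⟩ := hΦ
  obtain ⟨ψ, hψ, rfl⟩ := hΨ
  have := G.isIso_merge hd rfl
  refine ⟨(φ ⊗ₘ ψ) ≫ G.merge hd rfl, inferInstance, ?_⟩
  ext r χ
  constructor
  · rintro ⟨_, _, _, _, h, h', hd', hr, e⟩
    cases h
    cases h'
    cases hr
    cases e
    rfl
  · intro h
    cases h
    exact ⟨s, t, φ, ψ, rfl, rfl, hd, rfl, rfl⟩

/-- Unitors fill the other positions with units. Since positions are used, not objects, a repeated
object yields distinct atoms. -/
theorem exists_sharp : ∀ (l : List C) (i : Fin l.length),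
    ∃ φ : l.get i ⟶ (ofList l).obj (idx l i), IsIso φ
  | X :: l, i => by
    refine Fin.cases ?_ (fun j => ?_) i
    · have := (ofList l).isIso_unit
      exact ⟨(ρ_ X).inv ≫ X ◁ (ofList l).unit,
        inferInstanceAs (IsIso ((ρ_ X).inv ≫ X ◁ (ofList l).unit))⟩
    · obtain ⟨φ, hφ⟩ := exists_sharp l j
      exact ⟨(λ_ _).inv ≫ 𝟙_ C ◁ φ, inferInstanceAs (IsIso ((λ_ (l.get j)).inv ≫ 𝟙_ C ◁ φ))⟩

/-- The invertible arrow from a member of a list to its object. -/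
def atom (l : List C) (i : Fin l.length) (X : C) (h : l.get i = X) : Pt (ofList l) X :=
  singleton (eqToHom h.symm ≫ (exists_sharp l i).choose)

theorem sharp_atom (l : List C) (i : Fin l.length) (X : C) (h : l.get i = X) :
    Sharp (atom l i X h) (idx l i) := by
  have := (exists_sharp l i).choose_spec
  exact ⟨_, inferInstance, rfl⟩

end Pt
end Grading
end Coherence

/-! ### Exchanging the last two factors -/

section Exchange

variable {C : Type*} [Category C] [MonoidalCategory C] [SymmetricCategory C]

open Grading Pt

theorem exchangeRight_exchangeRight (X Y Z : C) :
    exchangeRight X Y Z ≫ exchangeRight X Z Y = 𝟙 _ := by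
  simp [exchangeRight, ← whiskerLeft_comp_assoc]

theorem exchangeRight_exchangeRight_assoc (X Y Z : C) {Q : C} (q : (X ⊗ Y) ⊗ Z ⟶ Q) :
    exchangeRight X Y Z ≫ exchangeRight X Z Y ≫ q = q := by
  rw [← Category.assoc, exchangeRight_exchangeRight, Category.id_comp]

theorem exchangeRight_natural_left {X X' : C} (f : X ⟶ X') (Y Z : C) :
    f ▷ Y ▷ Z ≫ exchangeRight X' Y Z = exchangeRight X Y Z ≫ f ▷ Z ▷ Y := by
  simp only [exchangeRight, associator_naturality_left_assoc, ← whisker_exchange_assoc,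
    associator_inv_naturality_left, Category.assoc]

theorem exchangeRight_natural_left_assoc {X X' : C} (f : X ⟶ X') (Y Z : C) {Q : C}
    (q : (X' ⊗ Z) ⊗ Y ⟶ Q) :
    f ▷ Y ▷ Z ≫ exchangeRight X' Y Z ≫ q = exchangeRight X Y Z ≫ f ▷ Z ▷ Y ≫ q := by
  rw [← Category.assoc, exchangeRight_natural_left, Category.assoc]

theorem exchangeRight_natural_middle (X : C) {Y Y' : C} (f : Y ⟶ Y') (Z : C) :
    (X ◁ f) ▷ Z ≫ exchangeRight X Y' Z = exchangeRight X Y Z ≫ (X ⊗ Z) ◁ f := by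
  have h := BraidedCategory.braiding_naturality_left f Z
  rw [exchangeRight, exchangeRight, associator_naturality_middle_assoc, ← whiskerLeft_comp_assoc, h,
    MonoidalCategory.whiskerLeft_comp_assoc, associator_inv_naturality_right]
  simp only [Category.assoc]

theorem exchangeRight_natural_middle_assoc (X : C) {Y Y' : C} (f : Y ⟶ Y') (Z : C) {Q : C}
    (q : (X ⊗ Z) ⊗ Y' ⟶ Q) :
    (X ◁ f) ▷ Z ≫ exchangeRight X Y' Z ≫ q = exchangeRight X Y Z ≫ (X ⊗ Z) ◁ f ≫ q := by
  rw [← Category.assoc, exchangeRight_natural_middle, Category.assoc]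

theorem exchangeRight_natural_right (X Y : C) {Z Z' : C} (f : Z ⟶ Z') :
    (X ⊗ Y) ◁ f ≫ exchangeRight X Y Z' = exchangeRight X Y Z ≫ (X ◁ f) ▷ Y := by
  have h := BraidedCategory.braiding_naturality_right Y f
  rw [exchangeRight, exchangeRight, associator_naturality_right_assoc, ← whiskerLeft_comp_assoc, h,
    MonoidalCategory.whiskerLeft_comp_assoc, associator_inv_naturality_middle]
  simp only [Category.assoc]

theorem exchangeRight_natural_right_assoc (X Y : C) {Z Z' : C} (f : Z ⟶ Z') {Q : C}
    (q : (X ⊗ Z') ⊗ Y ⟶ Q) :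
    (X ⊗ Y) ◁ f ≫ exchangeRight X Y Z' ≫ q = exchangeRight X Y Z ≫ (X ◁ f) ▷ Y ≫ q := by
  rw [← Category.assoc, exchangeRight_natural_right, Category.assoc]

theorem exchangeRight_yangBaxter (X Y Z W : C) :
    exchangeRight X Y Z ▷ W ≫ exchangeRight (X ⊗ Z) Y W ≫ exchangeRight X Z W ▷ Y =
      exchangeRight (X ⊗ Y) Z W ≫ exchangeRight X Y W ▷ Z ≫ exchangeRight (X ⊗ W) Y Z := by
  -- The common target is read as a product of atoms, which both sides pull back to the same
  -- product. The `rfl` closing each product is a disjointness check on Booleans. Later coherence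
  -- equations follow this pattern.
  let l := [X, Y, Z, W]
  refine ((((sharp_atom l 0 X rfl).tens (sharp_atom l 3 W rfl) rfl).tens
    (sharp_atom l 2 Z rfl) rfl).tens (sharp_atom l 1 Y rfl) rfl).eq_of_pre_eq ?_
  simp only [pre_comp, pre_exchangeRight, pre_whiskerRight]

end Exchange

/-! ### Properties of the trace -/

namespace SymmetricTrace

variable {C : Type*} [Category C] [MonoidalCategory C] [SymmetricCategory C]
  (t : SymmetricTrace C)

open Grading Pt

theorem tr_whiskerRight {U X Y : C} (f : X ⊗ U ⟶ Y ⊗ U) (A : C) :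
    t.tr U f ▷ A = t.tr U (exchangeRight X A U ≫ f ▷ A ≫ exchangeRight Y U A) := by
  simpa using t.superposing f (𝟙 A)

/-- The iterated traces are traces over `U ⊗ V` and over `V ⊗ U`; dinaturality along the symmetry
identifies these. -/
theorem tr_tr_comm {U V X Y : C} (f : (X ⊗ U) ⊗ V ⟶ (Y ⊗ U) ⊗ V) :
    t.tr U (t.tr V f) = t.tr V (t.tr U (exchangeRight X V U ≫ f ≫ exchangeRight Y U V)) := by
  have h₁ := t.vanishing_two ((α_ X U V).inv ≫ f ≫ (α_ Y U V).hom)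
  have h₂ := t.vanishing_two
    ((X ◁ (β_ V U).hom ≫ (α_ X U V).inv ≫ f ≫ (α_ Y U V).hom) ≫ Y ◁ (β_ U V).hom)
  have h₃ := t.dinatural (X ◁ (β_ V U).hom ≫ (α_ X U V).inv ≫ f ≫ (α_ Y U V).hom) (β_ U V).hom
  simp only [Category.assoc, Iso.hom_inv_id, Category.comp_id, Iso.hom_inv_id_assoc] at h₁ h₂ h₃
  rw [← h₁, exchangeRight, exchangeRight]
  simp only [Category.assoc]
  rw [← h₂, h₃, ← whiskerLeft_comp_assoc, SymmetricCategory.symmetry,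
    MonoidalCategory.whiskerLeft_id, Category.id_comp]

/-- Yanking in the presence of a spectator `X`: conjugation by the braiding moves `X` to the side
where superposing applies. -/
theorem tr_exchangeRight (X U : C) : t.tr U (exchangeRight X U U) = 𝟙 (X ⊗ U) := by
  have h := t.tr_whiskerRight (β_ U U).hom X
  rw [t.yanking, id_whiskerRight] at h
  have key : exchangeRight X U U = (β_ X U).hom ▷ U ≫
      (exchangeRight U X U ≫ (β_ U U).hom ▷ X ≫ exchangeRight U U X) ≫ (β_ U X).hom ▷ U := by
    -- The two strands `U` are kept apart by their positions in the list.
    let l := [X, U, U]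
    refine (((sharp_atom l 0 X rfl).tens (sharp_atom l 2 U rfl) rfl).tens
      (sharp_atom l 1 U rfl) rfl).eq_of_pre_eq ?_
    simp only [pre_comp, pre_exchangeRight, pre_whiskerRight, pre_braiding]
  rw [key, t.natural_left, t.natural_right, ← h, Category.id_comp, SymmetricCategory.symmetry]

/-- Superposing on the other side, obtained by conjugating with the braiding. -/
theorem tensorHom_tr {U X Y A B : C} (g : A ⟶ B) (f : X ⊗ U ⟶ Y ⊗ U) :
    g ⊗ₘ t.tr U f = t.tr U ((α_ A X U).hom ≫ (g ⊗ₘ f) ≫ (α_ B Y U).inv) := by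
  have h : g ⊗ₘ t.tr U f = (β_ A X).hom ≫ (t.tr U f ⊗ₘ g) ≫ (β_ Y B).hom := by
    rw [BraidedCategory.braiding_naturality, SymmetricCategory.symmetry_assoc]
  rw [h, t.superposing, ← t.natural_right, ← t.natural_left]
  congr 1
  have k₁ : (β_ A X).hom ▷ U ≫ exchangeRight X A U = (α_ A X U).hom ≫ (β_ A (X ⊗ U)).hom := by
    let l := [A, X, U]
    refine (((sharp_atom l 1 X rfl).tens (sharp_atom l 2 U rfl) rfl).tens
      (sharp_atom l 0 A rfl) rfl).eq_of_pre_eq ?_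
    simp only [pre_comp, pre_exchangeRight, pre_whiskerRight, pre_braiding, pre_associator_hom]
  have k₂ : exchangeRight Y U B ≫ (β_ Y B).hom ▷ U =
      (β_ (Y ⊗ U) B).hom ≫ (α_ B Y U).inv := by
    let l := [B, Y, U]
    refine (((sharp_atom l 0 B rfl).tens (sharp_atom l 1 Y rfl) rfl).tens
      (sharp_atom l 2 U rfl) rfl).eq_of_pre_eq ?_
    simp only [pre_comp, pre_exchangeRight, pre_whiskerRight, pre_braiding, pre_associator_inv]
  simp only [Category.assoc]
  rw [reassoc_of% k₁, k₂, BraidedCategory.braiding_naturality_assoc,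
    SymmetricCategory.symmetry_assoc]

end SymmetricTrace

/-! ### The category `Int C` -/

namespace IntHom

variable {C : Type*} [Category C] [MonoidalCategory C] 

section

variable [SymmetricCategory C] (t : SymmetricTrace C)

theorem comp_def {X U Y V Z W : C} (f : X ⊗ V ⟶ Y ⊗ U) (g : Y ⊗ W ⟶ Z ⊗ V) :
    comp t (A := ⟨X, U⟩) (B := ⟨Y, V⟩) (D := ⟨Z, W⟩) f g =
      t.tr V (exchangeRight X W V ≫ f ▷ W ≫ exchangeRight Y U W ≫ g ▷ U ≫
        exchangeRight Z V U) := rfl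

/-- `f` and `k` leave the trace on the left and `g` on the right; the trace of a bare exchange
remains, which is the identity. -/
theorem ofPair_comp {A B D : IntObj C} (f : A.pos ⟶ B.pos) (g : B.neg ⟶ A.neg) (k : IntHom B D) :
    comp t (ofPair f g) k =
      (f ▷ D.neg ≫ (show B.pos ⊗ D.neg ⟶ D.pos ⊗ B.neg from k) ≫ D.pos ◁ g :
        A.pos ⊗ D.neg ⟶ D.pos ⊗ A.neg) := by
  obtain ⟨X, U⟩ := A
  obtain ⟨Y, V⟩ := B
  obtain ⟨Z, W⟩ := D
  change X ⟶ Y at f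
  change V ⟶ U at g
  change Y ⊗ W ⟶ Z ⊗ V at k
  change t.tr V (exchangeRight X W V ≫ (f ⊗ₘ g) ▷ W ≫ exchangeRight Y U W ≫ k ▷ U ≫
        exchangeRight Z V U) = f ▷ W ≫ k ≫ Z ◁ g
  rw [MonoidalCategory.tensorHom_def, comp_whiskerRight, Category.assoc,
    exchangeRight_natural_middle_assoc,
    ← exchangeRight_natural_left_assoc, exchangeRight_exchangeRight_assoc, t.natural_left,
    whisker_exchange_assoc, t.natural_left, exchangeRight_natural_right, t.natural_right,
    t.tr_exchangeRight, Category.id_comp]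

theorem comp_ofPair {A B D : IntObj C} (k : IntHom A B) (f : B.pos ⟶ D.pos) (g : D.neg ⟶ B.neg) :
    comp t k (ofPair f g) =
      (A.pos ◁ g ≫ (show A.pos ⊗ B.neg ⟶ B.pos ⊗ A.neg from k) ≫ f ▷ A.neg :
        A.pos ⊗ D.neg ⟶ D.pos ⊗ A.neg) := by
  obtain ⟨X, U⟩ := A
  obtain ⟨Y, V⟩ := B
  obtain ⟨Z, W⟩ := D
  change Y ⟶ Z at f
  change W ⟶ V at g
  change X ⊗ V ⟶ Y ⊗ U at k
  change t.tr V (exchangeRight X W V ≫ k ▷ W ≫ exchangeRight Y U W ≫ (f ⊗ₘ g) ▷ U ≫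
        exchangeRight Z V U) = X ◁ g ≫ k ≫ f ▷ U
  -- Here `g` ends on the traced strand. Dinaturality carries it round the loop, and the trace over
  -- `V` becomes one over `W`.
  have h := t.dinatural
    (exchangeRight X W V ≫ k ▷ W ≫ exchangeRight Y U W ≫ f ▷ W ▷ U ≫ exchangeRight Z W U) g
  rw [MonoidalCategory.tensorHom_def, comp_whiskerRight, Category.assoc,
    exchangeRight_natural_middle]
  simp only [Category.assoc] at h
  rw [h, exchangeRight_natural_right_assoc, exchangeRight_natural_left,
    exchangeRight_exchangeRight_assoc, ← comp_whiskerRight, ← comp_whiskerRight, t.natural_right,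
    t.tr_exchangeRight, Category.id_comp]

/-- Superposing and naturality make both sides double traces over `V` and `W`, in opposite orders.
After `tr_tr_comm`, one Yang–Baxter equation before, between and after `f`, `g`, `k` matches the
integrands. -/
theorem comp_assoc {A B D E : IntObj C} (f : IntHom A B) (g : IntHom B D) (k : IntHom D E) :
    comp t (comp t f g) k = comp t f (comp t g k) := by
  obtain ⟨X, U⟩ := A
  obtain ⟨Y, V⟩ := B
  obtain ⟨Z, W⟩ := D
  obtain ⟨R, T⟩ := E
  change X ⊗ V ⟶ Y ⊗ U at f
  change Y ⊗ W ⟶ Z ⊗ V at g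
  change Z ⊗ T ⟶ R ⊗ W at k
  simp only [comp_def]
  change t.tr W (exchangeRight X T W ≫ t.tr V _ ▷ T ≫ _) =
    t.tr V (_ ≫ _ ≫ _ ≫ t.tr W _ ▷ U ≫ _)
  rw [t.tr_whiskerRight, t.tr_whiskerRight]
  simp only [← t.natural_right, ← t.natural_left]
  rw [t.tr_tr_comm (U := V)]
  congr 2
  simp only [comp_whiskerRight, Category.assoc]
  have y₁ := exchangeRight_yangBaxter X T W V
  have y₂ := exchangeRight_yangBaxter Y U T W
  have y₃ := exchangeRight_yangBaxter Z V U T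
  have y₄ := exchangeRight_yangBaxter R W V U
  rw [reassoc_of% y₁, ← exchangeRight_natural_left_assoc, reassoc_of% y₂,
    ← exchangeRight_natural_left_assoc, reassoc_of% y₃, ← exchangeRight_natural_left_assoc,
    reassoc_of% y₄, exchangeRight_exchangeRight, Category.comp_id]

end

end IntHom

/-! ### Functoriality of the tensor and naturality of the structure arrows of `Int C` -/

namespace IntHom

variable {C : Type*} [Category C] [MonoidalCategory C] [SymmetricCategory C]

open Grading Pt

/-- The permutation before the tensor of two arrows of `Int C`. -/
def tensorIn (X₁ V₁ X₂ V₂ : C) : (X₁ ⊗ X₂) ⊗ (V₂ ⊗ V₁) ⟶ (X₁ ⊗ V₁) ⊗ (X₂ ⊗ V₂) :=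
  (X₁ ⊗ X₂) ◁ (β_ V₂ V₁).hom ≫ tensorμ X₁ X₂ V₁ V₂

/-- The permutation after the tensor of two arrows of `Int C`. -/
def tensorOut (X₁ V₁ X₂ V₂ : C) : (X₁ ⊗ V₁) ⊗ (X₂ ⊗ V₂) ⟶ (X₁ ⊗ X₂) ⊗ (V₂ ⊗ V₁) :=
  tensorμ X₁ V₁ X₂ V₂ ≫ (X₁ ⊗ X₂) ◁ (β_ V₁ V₂).hom

theorem pre_tensorIn {G : Grading C} {X₁ V₁ X₂ V₂ : C} (x₁ : Pt G X₁) (v₁ : Pt G V₁)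
    (x₂ : Pt G X₂) (v₂ : Pt G V₂) :
    pre (tensorIn X₁ V₁ X₂ V₂) (tens (tens x₁ v₁) (tens x₂ v₂)) =
      tens (tens x₁ x₂) (tens v₂ v₁) := by
  simp only [tensorIn, pre_comp, pre_tensorμ, pre_whiskerLeft, pre_braiding]

theorem pre_tensorOut {G : Grading C} {X₁ V₁ X₂ V₂ : C} (x₁ : Pt G X₁) (v₁ : Pt G V₁)
    (x₂ : Pt G X₂) (v₂ : Pt G V₂) :
    pre (tensorOut X₁ V₁ X₂ V₂) (tens (tens x₁ x₂) (tens v₂ v₁)) =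
      tens (tens x₁ v₁) (tens x₂ v₂) := by
  simp only [tensorOut, pre_comp, pre_tensorμ, pre_whiskerLeft, pre_braiding]

theorem tensorIn_tensorOut (X₁ V₁ X₂ V₂ : C) :
    tensorIn X₁ V₁ X₂ V₂ ≫ tensorOut X₁ V₁ X₂ V₂ = 𝟙 _ := by
  let l := [X₁, V₁, X₂, V₂]
  refine (((sharp_atom l 0 X₁ rfl).tens (sharp_atom l 2 X₂ rfl) rfl).tens
    ((sharp_atom l 3 V₂ rfl).tens (sharp_atom l 1 V₁ rfl) rfl) rfl).eq_of_pre_eq ?_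
  simp only [pre_comp, pre_tensorIn, pre_tensorOut, pre_id]

theorem tensorIn_natural {X₁ V₁ X₂ V₂ Y₁ U₁ Y₂ U₂ : C} (a₁ : X₁ ⟶ Y₁) (b₁ : V₁ ⟶ U₁)
    (a₂ : X₂ ⟶ Y₂) (b₂ : V₂ ⟶ U₂) :
    ((a₁ ⊗ₘ a₂) ⊗ₘ (b₂ ⊗ₘ b₁)) ≫ tensorIn Y₁ U₁ Y₂ U₂ =
      tensorIn X₁ V₁ X₂ V₂ ≫ ((a₁ ⊗ₘ b₁) ⊗ₘ (a₂ ⊗ₘ b₂)) := by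
  have h : ((a₁ ⊗ₘ a₂) ⊗ₘ (b₂ ⊗ₘ b₁)) ≫ (Y₁ ⊗ Y₂) ◁ (β_ U₂ U₁).hom =
      (X₁ ⊗ X₂) ◁ (β_ V₂ V₁).hom ≫ ((a₁ ⊗ₘ a₂) ⊗ₘ (b₁ ⊗ₘ b₂)) := by
    rw [← id_tensorHom, ← id_tensorHom, tensorHom_comp_tensorHom, tensorHom_comp_tensorHom,
      BraidedCategory.braiding_naturality, Category.id_comp, Category.comp_id]
  rw [tensorIn, reassoc_of% h, tensorμ_natural, tensorIn, Category.assoc]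

/-- The tensor of two arrows of `Int C`, as an arrow of `C`. -/
def tensorArrow {X₁ U₁ Y₁ V₁ X₂ U₂ Y₂ V₂ : C} (f : X₁ ⊗ V₁ ⟶ Y₁ ⊗ U₁)
    (g : X₂ ⊗ V₂ ⟶ Y₂ ⊗ U₂) : (X₁ ⊗ X₂) ⊗ (V₂ ⊗ V₁) ⟶ (Y₁ ⊗ Y₂) ⊗ (U₂ ⊗ U₁) :=
  tensor (A₁ := ⟨X₁, U₁⟩) (B₁ := ⟨Y₁, V₁⟩) (A₂ := ⟨X₂, U₂⟩) (B₂ := ⟨Y₂, V₂⟩) f g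

theorem tensorArrow_eq {X₁ U₁ Y₁ V₁ X₂ U₂ Y₂ V₂ : C} (f : X₁ ⊗ V₁ ⟶ Y₁ ⊗ U₁)
    (g : X₂ ⊗ V₂ ⟶ Y₂ ⊗ U₂) :
    tensorArrow f g = tensorIn X₁ V₁ X₂ V₂ ≫ (f ⊗ₘ g) ≫ tensorOut Y₁ U₁ Y₂ U₂ := by
  simp only [tensorIn, tensorOut, Category.assoc]
  rfl

theorem tensor_ofPair {A₁ B₁ A₂ B₂ : IntObj C} (f₁ : A₁.pos ⟶ B₁.pos) (g₁ : B₁.neg ⟶ A₁.neg)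
    (f₂ : A₂.pos ⟶ B₂.pos) (g₂ : B₂.neg ⟶ A₂.neg) :
    tensor (ofPair f₁ g₁) (ofPair f₂ g₂) =
      ofPair (A := A₁.tensor A₂) (B := B₁.tensor B₂) (f₁ ⊗ₘ f₂) (g₂ ⊗ₘ g₁) := by
  change tensorArrow (f₁ ⊗ₘ g₁) (f₂ ⊗ₘ g₂) = ((f₁ ⊗ₘ f₂) ⊗ₘ (g₂ ⊗ₘ g₁))
  rw [tensorArrow_eq, ← Category.assoc, ← tensorIn_natural, Category.assoc, tensorIn_tensorOut,
    Category.comp_id]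

/-- This equation and the next two compare the two sides of `tensor_comp` before the first pair of
arrows, between the pairs, and after the second. -/
theorem tensor_comp_permutation_source (X₁ V₁ W₁ X₂ V₂ W₂ : C) :
    (α_ ((X₁ ⊗ X₂) ⊗ (W₂ ⊗ W₁)) V₂ V₁).hom ≫
      exchangeRight (X₁ ⊗ X₂) (W₂ ⊗ W₁) (V₂ ⊗ V₁) ≫
      tensorIn X₁ V₁ X₂ V₂ ▷ (W₂ ⊗ W₁) ≫ tensorIn (X₁ ⊗ V₁) W₁ (X₂ ⊗ V₂) W₂ =
    tensorIn X₁ W₁ X₂ W₂ ▷ V₂ ▷ V₁ ≫ (α_ (X₁ ⊗ W₁) (X₂ ⊗ W₂) V₂).hom ▷ V₁ ≫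
      exchangeRight (X₁ ⊗ W₁) ((X₂ ⊗ W₂) ⊗ V₂) V₁ ≫
      (exchangeRight X₁ W₁ V₁ ⊗ₘ exchangeRight X₂ W₂ V₂) := by
  let l := [X₁, V₁, W₁, X₂, V₂, W₂]
  refine ((((sharp_atom l 0 X₁ rfl).tens (sharp_atom l 1 V₁ rfl) rfl).tens
    (sharp_atom l 2 W₁ rfl) rfl).tens (((sharp_atom l 3 X₂ rfl).tens
      (sharp_atom l 4 V₂ rfl) rfl).tens (sharp_atom l 5 W₂ rfl) rfl) rfl).eq_of_pre_eq ?_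
  simp only [pre_comp, pre_tensorIn, pre_exchangeRight, pre_whiskerRight, pre_tensorHom,
    pre_associator_hom]

theorem tensor_comp_permutation_middle (Y₁ U₁ W₁ Y₂ U₂ W₂ : C) :
    tensorOut (Y₁ ⊗ U₁) W₁ (Y₂ ⊗ U₂) W₂ ≫ tensorOut Y₁ U₁ Y₂ U₂ ▷ (W₂ ⊗ W₁) ≫
      exchangeRight (Y₁ ⊗ Y₂) (U₂ ⊗ U₁) (W₂ ⊗ W₁) ≫
      tensorIn Y₁ W₁ Y₂ W₂ ▷ (U₂ ⊗ U₁) ≫ tensorIn (Y₁ ⊗ W₁) U₁ (Y₂ ⊗ W₂) U₂ =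
    (exchangeRight Y₁ U₁ W₁ ⊗ₘ exchangeRight Y₂ U₂ W₂) := by
  let l := [Y₁, W₁, U₁, Y₂, W₂, U₂]
  refine ((((sharp_atom l 0 Y₁ rfl).tens (sharp_atom l 1 W₁ rfl) rfl).tens
    (sharp_atom l 2 U₁ rfl) rfl).tens (((sharp_atom l 3 Y₂ rfl).tens
      (sharp_atom l 4 W₂ rfl) rfl).tens (sharp_atom l 5 U₂ rfl) rfl) rfl).eq_of_pre_eq ?_
  simp only [pre_comp, pre_tensorIn, pre_tensorOut, pre_exchangeRight, pre_whiskerRight,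
    pre_tensorHom]

theorem tensor_comp_permutation_target (Z₁ U₁ V₁ Z₂ U₂ V₂ : C) :
    tensorOut (Z₁ ⊗ V₁) U₁ (Z₂ ⊗ V₂) U₂ ≫ tensorOut Z₁ V₁ Z₂ V₂ ▷ (U₂ ⊗ U₁) ≫
      exchangeRight (Z₁ ⊗ Z₂) (V₂ ⊗ V₁) (U₂ ⊗ U₁) ≫
      (α_ ((Z₁ ⊗ Z₂) ⊗ (U₂ ⊗ U₁)) V₂ V₁).inv =
    (exchangeRight Z₁ V₁ U₁ ⊗ₘ exchangeRight Z₂ V₂ U₂) ≫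
      exchangeRight (Z₁ ⊗ U₁) V₁ ((Z₂ ⊗ U₂) ⊗ V₂) ≫
      (α_ (Z₁ ⊗ U₁) (Z₂ ⊗ U₂) V₂).inv ▷ V₁ ≫ tensorOut Z₁ U₁ Z₂ U₂ ▷ V₂ ▷ V₁ := by
  let l := [Z₁, U₁, V₁, Z₂, U₂, V₂]
  refine (((((sharp_atom l 0 Z₁ rfl).tens (sharp_atom l 3 Z₂ rfl) rfl).tens
    ((sharp_atom l 4 U₂ rfl).tens (sharp_atom l 1 U₁ rfl) rfl) rfl).tens
    (sharp_atom l 5 V₂ rfl) rfl).tens (sharp_atom l 2 V₁ rfl) rfl).eq_of_pre_eq ?_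
  simp only [pre_comp, pre_tensorOut, pre_exchangeRight, pre_whiskerRight, pre_tensorHom,
    pre_associator_inv]

/-- Isolates the permutations around a whiskered product, so that they can be merged with
neighbouring ones. -/
theorem whiskerRight_tensorHom {X₁ X₂ Y₁ Y₂ : C} (f : X₁ ⟶ Y₁) (g : X₂ ⟶ Y₂) (W₁ W₂ : C) :
    (f ⊗ₘ g) ▷ (W₂ ⊗ W₁) =
      tensorIn X₁ W₁ X₂ W₂ ≫ (f ▷ W₁ ⊗ₘ g ▷ W₂) ≫ tensorOut Y₁ W₁ Y₂ W₂ := by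
  have h := tensorIn_natural f (𝟙 W₁) g (𝟙 W₂) =≫ tensorOut Y₁ W₁ Y₂ W₂
  rw [Category.assoc, tensorIn_tensorOut] at h
  simpa using h

/-- Vanishing splits the trace over `V₂ ⊗ V₁` into two successive traces, and superposing turns the
product of two traces into such a double trace. Only permutations are left to compare. -/
theorem tensor_comp (t : SymmetricTrace C) {A₁ B₁ D₁ A₂ B₂ D₂ : IntObj C} (f₁ : IntHom A₁ B₁)
    (g₁ : IntHom B₁ D₁) (f₂ : IntHom A₂ B₂) (g₂ : IntHom B₂ D₂) :
    comp t (tensor f₁ f₂) (tensor g₁ g₂) = tensor (comp t f₁ g₁) (comp t f₂ g₂) := by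
  obtain ⟨X₁, U₁⟩ := A₁
  obtain ⟨Y₁, V₁⟩ := B₁
  obtain ⟨Z₁, W₁⟩ := D₁
  obtain ⟨X₂, U₂⟩ := A₂
  obtain ⟨Y₂, V₂⟩ := B₂
  obtain ⟨Z₂, W₂⟩ := D₂
  change X₁ ⊗ V₁ ⟶ Y₁ ⊗ U₁ at f₁
  change Y₁ ⊗ W₁ ⟶ Z₁ ⊗ V₁ at g₁
  change X₂ ⊗ V₂ ⟶ Y₂ ⊗ U₂ at f₂
  change Y₂ ⊗ W₂ ⟶ Z₂ ⊗ V₂ at g₂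
  change t.tr (V₂ ⊗ V₁) (exchangeRight (X₁ ⊗ X₂) (W₂ ⊗ W₁) (V₂ ⊗ V₁) ≫
      tensorArrow f₁ f₂ ▷ (W₂ ⊗ W₁) ≫ exchangeRight (Y₁ ⊗ Y₂) (U₂ ⊗ U₁) (W₂ ⊗ W₁) ≫
      tensorArrow g₁ g₂ ▷ (U₂ ⊗ U₁) ≫ exchangeRight (Z₁ ⊗ Z₂) (V₂ ⊗ V₁) (U₂ ⊗ U₁)) =
    tensorArrow
      (t.tr V₁ (exchangeRight X₁ W₁ V₁ ≫ f₁ ▷ W₁ ≫ exchangeRight Y₁ U₁ W₁ ≫ g₁ ▷ U₁ ≫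
        exchangeRight Z₁ V₁ U₁))
      (t.tr V₂ (exchangeRight X₂ W₂ V₂ ≫ f₂ ▷ W₂ ≫ exchangeRight Y₂ U₂ W₂ ≫ g₂ ▷ U₂ ≫
        exchangeRight Z₂ V₂ U₂))
  rw [tensorArrow_eq, tensorArrow_eq, tensorArrow_eq, t.vanishing_two, t.tensorHom_tr,
    t.superposing]
  simp only [← t.natural_right, ← t.natural_left]
  congr 2
  simp only [comp_whiskerRight, Category.assoc, whiskerRight_tensorHom]
  have h₁ := tensor_comp_permutation_source X₁ V₁ W₁ X₂ V₂ W₂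
  have h₂ := tensor_comp_permutation_middle Y₁ U₁ W₁ Y₂ U₂ W₂
  have h₃ := tensor_comp_permutation_target Z₁ U₁ V₁ Z₂ U₂ V₂
  rw [h₃, reassoc_of% h₂, reassoc_of% h₁]
  simp only [tensorHom_comp_tensorHom_assoc]

/-- Associators are pairs, so the traces vanish; the permutations on either side of `f₁ ⊗ f₂ ⊗ f₃`
are then compared separately. -/
theorem assoc_natural (t : SymmetricTrace C) {A₁ B₁ A₂ B₂ A₃ B₃ : IntObj C} (f₁ : IntHom A₁ B₁)
    (f₂ : IntHom A₂ B₂) (f₃ : IntHom A₃ B₃) :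
    comp t (tensor f₁ (tensor f₂ f₃)) (assoc B₁ B₂ B₃) =
      comp t (assoc A₁ A₂ A₃) (tensor (tensor f₁ f₂) f₃) := by
  obtain ⟨X₁, U₁⟩ := A₁
  obtain ⟨Y₁, V₁⟩ := B₁
  obtain ⟨X₂, U₂⟩ := A₂
  obtain ⟨Y₂, V₂⟩ := B₂
  obtain ⟨X₃, U₃⟩ := A₃
  obtain ⟨Y₃, V₃⟩ := B₃
  change X₁ ⊗ V₁ ⟶ Y₁ ⊗ U₁ at f₁
  change X₂ ⊗ V₂ ⟶ Y₂ ⊗ U₂ at f₂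
  change X₃ ⊗ V₃ ⟶ Y₃ ⊗ U₃ at f₃
  refine (comp_ofPair t _ _ _).trans (Eq.trans ?_ (ofPair_comp t _ _ _).symm)
  change (X₁ ⊗ X₂ ⊗ X₃) ◁ (α_ V₃ V₂ V₁).inv ≫ tensorArrow f₁ (tensorArrow f₂ f₃) ≫
      (α_ Y₁ Y₂ Y₃).inv ▷ ((U₃ ⊗ U₂) ⊗ U₁) =
    (α_ X₁ X₂ X₃).inv ▷ (V₃ ⊗ V₂ ⊗ V₁) ≫ tensorArrow (tensorArrow f₁ f₂) f₃ ≫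
      ((Y₁ ⊗ Y₂) ⊗ Y₃) ◁ (α_ U₃ U₂ U₁).inv
  rw [tensorArrow_eq, tensorArrow_eq, tensorArrow_eq, tensorArrow_eq]
  have h₁ : (X₁ ⊗ X₂ ⊗ X₃) ◁ (α_ V₃ V₂ V₁).inv ≫ tensorIn X₁ V₁ (X₂ ⊗ X₃) (V₃ ⊗ V₂) ≫
      (X₁ ⊗ V₁) ◁ tensorIn X₂ V₂ X₃ V₃ =
    (α_ X₁ X₂ X₃).inv ▷ (V₃ ⊗ V₂ ⊗ V₁) ≫ tensorIn (X₁ ⊗ X₂) (V₂ ⊗ V₁) X₃ V₃ ≫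
      tensorIn X₁ V₁ X₂ V₂ ▷ (X₃ ⊗ V₃) ≫ (α_ _ _ _).hom := by
    let l := [X₁, V₁, X₂, V₂, X₃, V₃]
    refine (((sharp_atom l 0 X₁ rfl).tens (sharp_atom l 1 V₁ rfl) rfl).tens
      (((sharp_atom l 2 X₂ rfl).tens (sharp_atom l 3 V₂ rfl) rfl).tens
      ((sharp_atom l 4 X₃ rfl).tens (sharp_atom l 5 V₃ rfl) rfl) rfl) rfl).eq_of_pre_eq ?_
    simp only [pre_comp, pre_tensorIn, pre_whiskerRight, pre_whiskerLeft, pre_associator_hom,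
      pre_associator_inv]
  have h₂ : (Y₁ ⊗ U₁) ◁ tensorOut Y₂ U₂ Y₃ U₃ ≫ tensorOut Y₁ U₁ (Y₂ ⊗ Y₃) (U₃ ⊗ U₂) ≫
      (α_ Y₁ Y₂ Y₃).inv ▷ ((U₃ ⊗ U₂) ⊗ U₁) =
    (α_ _ _ _).inv ≫ tensorOut Y₁ U₁ Y₂ U₂ ▷ (Y₃ ⊗ U₃) ≫
      tensorOut (Y₁ ⊗ Y₂) (U₂ ⊗ U₁) Y₃ U₃ ≫ ((Y₁ ⊗ Y₂) ⊗ Y₃) ◁ (α_ U₃ U₂ U₁).inv := by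
    let l := [Y₁, U₁, Y₂, U₂, Y₃, U₃]
    refine ((((sharp_atom l 0 Y₁ rfl).tens (sharp_atom l 2 Y₂ rfl) rfl).tens
      (sharp_atom l 4 Y₃ rfl) rfl).tens (((sharp_atom l 5 U₃ rfl).tens
      (sharp_atom l 3 U₂ rfl) rfl).tens (sharp_atom l 1 U₁ rfl) rfl) rfl).eq_of_pre_eq ?_
    simp only [pre_comp, pre_tensorOut, pre_whiskerRight, pre_whiskerLeft,
      pre_associator_inv]
  have h₃ : (f₁ ⊗ₘ (tensorIn X₂ V₂ X₃ V₃ ≫ (f₂ ⊗ₘ f₃) ≫ tensorOut Y₂ U₂ Y₃ U₃)) =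
      (X₁ ⊗ V₁) ◁ tensorIn X₂ V₂ X₃ V₃ ≫ (f₁ ⊗ₘ f₂ ⊗ₘ f₃) ≫
        (Y₁ ⊗ U₁) ◁ tensorOut Y₂ U₂ Y₃ U₃ := by
    simp only [← id_tensorHom, tensorHom_comp_tensorHom, Category.id_comp, Category.comp_id]
  have h₄ : ((tensorIn X₁ V₁ X₂ V₂ ≫ (f₁ ⊗ₘ f₂) ≫ tensorOut Y₁ U₁ Y₂ U₂) ⊗ₘ f₃) =
      tensorIn X₁ V₁ X₂ V₂ ▷ (X₃ ⊗ V₃) ≫ ((f₁ ⊗ₘ f₂) ⊗ₘ f₃) ≫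
        tensorOut Y₁ U₁ Y₂ U₂ ▷ (Y₃ ⊗ U₃) := by
    simp only [← tensorHom_id, tensorHom_comp_tensorHom, Category.id_comp, Category.comp_id]
  rw [h₃, h₄]
  simp only [Category.assoc]
  rw [h₂, reassoc_of% h₁, ← associator_naturality_assoc, Iso.hom_inv_id_assoc]

theorem symm_natural (t : SymmetricTrace C) {A₁ B₁ A₂ B₂ : IntObj C} (f₁ : IntHom A₁ B₁)
    (f₂ : IntHom A₂ B₂) :
    comp t (tensor f₁ f₂) (symm B₁ B₂) = comp t (symm A₁ A₂) (tensor f₂ f₁) := by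
  obtain ⟨X₁, U₁⟩ := A₁
  obtain ⟨Y₁, V₁⟩ := B₁
  obtain ⟨X₂, U₂⟩ := A₂
  obtain ⟨Y₂, V₂⟩ := B₂
  change X₁ ⊗ V₁ ⟶ Y₁ ⊗ U₁ at f₁
  change X₂ ⊗ V₂ ⟶ Y₂ ⊗ U₂ at f₂
  refine (comp_ofPair t _ _ _).trans (Eq.trans ?_ (ofPair_comp t _ _ _).symm)
  change (X₁ ⊗ X₂) ◁ (β_ V₁ V₂).hom ≫ tensorArrow f₁ f₂ ≫ (β_ Y₁ Y₂).hom ▷ (U₂ ⊗ U₁) =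
    (β_ X₁ X₂).hom ▷ (V₁ ⊗ V₂) ≫ tensorArrow f₂ f₁ ≫ (Y₂ ⊗ Y₁) ◁ (β_ U₁ U₂).hom
  rw [tensorArrow_eq, tensorArrow_eq]
  have h₁ : (X₁ ⊗ X₂) ◁ (β_ V₁ V₂).hom ≫ tensorIn X₁ V₁ X₂ V₂ =
      (β_ X₁ X₂).hom ▷ (V₁ ⊗ V₂) ≫ tensorIn X₂ V₂ X₁ V₁ ≫ (β_ _ _).hom := by
    let l := [X₁, V₁, X₂, V₂]
    refine (((sharp_atom l 0 X₁ rfl).tens (sharp_atom l 1 V₁ rfl) rfl).tens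
      ((sharp_atom l 2 X₂ rfl).tens (sharp_atom l 3 V₂ rfl) rfl) rfl).eq_of_pre_eq ?_
    simp only [pre_comp, pre_tensorIn, pre_whiskerRight, pre_whiskerLeft, pre_braiding]
  have h₂ : tensorOut Y₁ U₁ Y₂ U₂ ≫ (β_ Y₁ Y₂).hom ▷ (U₂ ⊗ U₁) =
      (β_ _ _).hom ≫ tensorOut Y₂ U₂ Y₁ U₁ ≫ (Y₂ ⊗ Y₁) ◁ (β_ U₁ U₂).hom := by
    let l := [Y₁, U₁, Y₂, U₂]
    refine (((sharp_atom l 2 Y₂ rfl).tens (sharp_atom l 0 Y₁ rfl) rfl).tens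
      ((sharp_atom l 3 U₂ rfl).tens (sharp_atom l 1 U₁ rfl) rfl) rfl).eq_of_pre_eq ?_
    simp only [pre_comp, pre_tensorOut, pre_whiskerRight, pre_whiskerLeft, pre_braiding]
  simp only [Category.assoc]
  rw [h₂, reassoc_of% h₁, BraidedCategory.braiding_naturality_assoc,
    SymmetricCategory.symmetry_assoc]

/-- The right unitor `A □ (I, I) ⟶ A`. -/
def rightUnitor (A : IntObj C) : IntHom (A.tensor (IntObj.unit C)) A :=
  ofPair (ρ_ A.pos).hom (λ_ A.neg).inv

theorem leftUnitor_natural (t : SymmetricTrace C) {A B : IntObj C} (f : IntHom A B) :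
    comp t (tensor (id (IntObj.unit C)) f) (leftUnitor B) = comp t (leftUnitor A) f := by
  obtain ⟨X, U⟩ := A
  obtain ⟨Y, V⟩ := B
  change X ⊗ V ⟶ Y ⊗ U at f
  refine (comp_ofPair t _ _ _).trans (Eq.trans ?_ (ofPair_comp t _ _ _).symm)
  change (𝟙_ C ⊗ X) ◁ (ρ_ V).inv ≫ tensorArrow (𝟙 (𝟙_ C) ⊗ₘ 𝟙 (𝟙_ C)) f ≫ (λ_ Y).hom ▷ (U ⊗ 𝟙_ C) =
    (λ_ X).hom ▷ V ≫ f ≫ Y ◁ (ρ_ U).inv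
  rw [tensorArrow_eq]
  have h₁ : (𝟙_ C ⊗ X) ◁ (ρ_ V).inv ≫ tensorIn (𝟙_ C) (𝟙_ C) X V =
      (λ_ X).hom ▷ V ≫ (λ_ (X ⊗ V)).inv ≫ (λ_ (𝟙_ C)).inv ▷ (X ⊗ V) := by
    let l := [X, V]
    refine ((sharp_one.tens sharp_one rfl).tens ((sharp_atom l 0 X rfl).tens
      (sharp_atom l 1 V rfl) rfl) rfl).eq_of_pre_eq ?_
    simp only [pre_comp, pre_tensorIn, pre_whiskerRight, pre_whiskerLeft, pre_leftUnitor_hom,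
      pre_leftUnitor_inv, pre_rightUnitor_inv]
  have h₂ : (λ_ (𝟙_ C)).inv ▷ (Y ⊗ U) ≫ tensorOut (𝟙_ C) (𝟙_ C) Y U ≫ (λ_ Y).hom ▷ (U ⊗ 𝟙_ C) =
      (λ_ (Y ⊗ U)).hom ≫ Y ◁ (ρ_ U).inv := by
    let l := [Y, U]
    refine ((sharp_atom l 0 Y rfl).tens ((sharp_atom l 1 U rfl).tens sharp_one rfl)
      rfl).eq_of_pre_eq ?_
    simp only [pre_comp, pre_tensorOut, pre_whiskerRight, pre_whiskerLeft, pre_leftUnitor_hom,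
      pre_leftUnitor_inv, pre_rightUnitor_inv]
  simp only [Category.assoc]
  rw [reassoc_of% h₁, id_tensorHom_id, id_tensorHom, ← whisker_exchange_assoc, h₂,
    leftUnitor_naturality_assoc, Iso.inv_hom_id_assoc]

theorem rightUnitor_natural (t : SymmetricTrace C) {A B : IntObj C} (f : IntHom A B) :
    comp t (tensor f (id (IntObj.unit C))) (rightUnitor B) = comp t (rightUnitor A) f := by
  obtain ⟨X, U⟩ := A
  obtain ⟨Y, V⟩ := B
  change X ⊗ V ⟶ Y ⊗ U at f
  refine (comp_ofPair t _ _ _).trans (Eq.trans ?_ (ofPair_comp t _ _ _).symm)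
  change (X ⊗ 𝟙_ C) ◁ (λ_ V).inv ≫ tensorArrow f (𝟙 (𝟙_ C) ⊗ₘ 𝟙 (𝟙_ C)) ≫ (ρ_ Y).hom ▷ (𝟙_ C ⊗ U) =
    (ρ_ X).hom ▷ V ≫ f ≫ Y ◁ (λ_ U).inv
  rw [tensorArrow_eq]
  have h₁ : (X ⊗ 𝟙_ C) ◁ (λ_ V).inv ≫ tensorIn X V (𝟙_ C) (𝟙_ C) =
      (ρ_ X).hom ▷ V ≫ (ρ_ (X ⊗ V)).inv ≫ (X ⊗ V) ◁ (λ_ (𝟙_ C)).inv := by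
    let l := [X, V]
    refine (((sharp_atom l 0 X rfl).tens (sharp_atom l 1 V rfl) rfl).tens
      (sharp_one.tens sharp_one rfl) rfl).eq_of_pre_eq ?_
    simp only [pre_comp, pre_tensorIn, pre_whiskerRight, pre_whiskerLeft, pre_rightUnitor_hom,
      pre_leftUnitor_inv, pre_rightUnitor_inv]
  have h₂ : (Y ⊗ U) ◁ (λ_ (𝟙_ C)).inv ≫ tensorOut Y U (𝟙_ C) (𝟙_ C) ≫ (ρ_ Y).hom ▷ (𝟙_ C ⊗ U) =
      (ρ_ (Y ⊗ U)).hom ≫ Y ◁ (λ_ U).inv := by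
    let l := [Y, U]
    refine ((sharp_atom l 0 Y rfl).tens (sharp_one.tens (sharp_atom l 1 U rfl) rfl)
      rfl).eq_of_pre_eq ?_
    simp only [pre_comp, pre_tensorOut, pre_whiskerRight, pre_whiskerLeft, pre_rightUnitor_hom,
      pre_leftUnitor_inv]
  simp only [Category.assoc]
  rw [reassoc_of% h₁, id_tensorHom_id, tensorHom_id, whisker_exchange_assoc, h₂,
    rightUnitor_naturality_assoc, Iso.inv_hom_id_assoc]

end IntHom

/-! ### The monoidal category `Int C` -/

namespace IntHom

section

variable {C : Type*} [Category C] [MonoidalCategory C]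

theorem ofPair_congr {A B : IntObj C} {f f' : A.pos ⟶ B.pos} {g g' : B.neg ⟶ A.neg}
    (hf : f = f') (hg : g = g') : (ofPair f g : IntHom A B) = ofPair f' g' := by rw [hf, hg]

variable [SymmetricCategory C] (t : SymmetricTrace C)

theorem ofPair_comp_ofPair {A B D : IntObj C} (f : A.pos ⟶ B.pos) (g : B.neg ⟶ A.neg)
    (f' : B.pos ⟶ D.pos) (g' : D.neg ⟶ B.neg) :
    comp t (ofPair f g) (ofPair f' g') = ofPair (f ≫ f') (g' ≫ g) := by
  rw [ofPair_comp]
  change f ▷ D.neg ≫ (f' ⊗ₘ g') ≫ D.pos ◁ g = ((f ≫ f') ⊗ₘ (g' ≫ g))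
  simp [MonoidalCategory.tensorHom_def]

theorem id_comp {A B : IntObj C} (f : IntHom A B) : comp t (id A) f = f := by
  rw [id, ofPair_comp]
  change 𝟙 _ ▷ _ ≫ f ≫ _ ◁ 𝟙 _ = f
  rw [MonoidalCategory.whiskerLeft_id, id_whiskerRight]
  exact (Category.id_comp _).trans (Category.comp_id _)

theorem comp_id {A B : IntObj C} (f : IntHom A B) : comp t f (id B) = f := by
  rw [id, comp_ofPair]
  change _ ◁ 𝟙 _ ≫ f ≫ 𝟙 _ ▷ _ = f
  rw [MonoidalCategory.whiskerLeft_id, id_whiskerRight]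
  exact (Category.id_comp _).trans (Category.comp_id _)

theorem tensor_id (A B : IntObj C) : tensor (id A) (id B) = id (A.tensor B) := by
  simp only [id]
  rw [tensor_ofPair]
  exact ofPair_congr (id_tensorHom_id _ _) (id_tensorHom_id _ _)

/-- Equational hypotheses let `rfl` supply the pair form of an arrow that unfolds to a pair. -/
theorem comp_eq_ofPair {A B D : IntObj C} {F : IntHom A B} {G : IntHom B D} {f : A.pos ⟶ B.pos}
    {g : B.neg ⟶ A.neg} {f' : B.pos ⟶ D.pos} {g' : D.neg ⟶ B.neg} (hF : F = ofPair f g)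
    (hG : G = ofPair f' g') : comp t F G = ofPair (f ≫ f') (g' ≫ g) := by
  rw [hF, hG, ofPair_comp_ofPair]

theorem tensor_eq_ofPair {A₁ B₁ A₂ B₂ : IntObj C} {F : IntHom A₁ B₁} {G : IntHom A₂ B₂}
    {f₁ : A₁.pos ⟶ B₁.pos} {g₁ : B₁.neg ⟶ A₁.neg} {f₂ : A₂.pos ⟶ B₂.pos} {g₂ : B₂.neg ⟶ A₂.neg}
    (hF : F = ofPair f₁ g₁) (hG : G = ofPair f₂ g₂) :
    tensor F G = ofPair (A := A₁.tensor A₂) (B := B₁.tensor B₂) (f₁ ⊗ₘ f₂) (g₂ ⊗ₘ g₁) := by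
  rw [hF, hG, tensor_ofPair]

/-- Every arrow is a pair, so the axiom splits into two pentagons of `C`, the contravariant one with
the objects in reverse order. -/
theorem pentagon (A B D E : IntObj C) :
    comp t (tensor (assocInv A B D) (id E)) (comp t (assocInv A (B.tensor D) E)
      (tensor (id A) (assocInv B D E))) =
    comp t (assocInv (A.tensor B) D E) (assocInv A B (D.tensor E)) := by
  refine (comp_eq_ofPair t (tensor_eq_ofPair rfl rfl) (comp_eq_ofPair t rfl
    (tensor_eq_ofPair rfl rfl))).trans (Eq.trans ?_ (comp_eq_ofPair t rfl rfl).symm)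
  refine ofPair_congr ?_ ?_
  · have h := MonoidalCategory.pentagon A.pos B.pos D.pos E.pos
    rw [← tensorHom_id, ← id_tensorHom] at h
    exact h
  · have h := MonoidalCategory.pentagon E.neg D.neg B.neg A.neg
    rw [← tensorHom_id, ← id_tensorHom, ← Category.assoc] at h
    exact h

theorem triangle (A B : IntObj C) :
    comp t (assocInv A (IntObj.unit C) B) (tensor (id A) (leftUnitor B)) =
      tensor (rightUnitor A) (id B) := by
  refine (comp_eq_ofPair t rfl (tensor_eq_ofPair rfl rfl)).trans
    (Eq.trans ?_ (tensor_eq_ofPair rfl rfl).symm)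
  refine ofPair_congr ?_ ?_
  · have h := MonoidalCategory.triangle A.pos B.pos
    rw [← tensorHom_id, ← id_tensorHom] at h
    exact h
  · have h := triangle_assoc_comp_right_inv B.neg A.neg
    rw [← tensorHom_id, ← id_tensorHom] at h
    exact h

theorem assoc_assocInv (A B D : IntObj C) :
    comp t (assoc A B D) (assocInv A B D) = id (A.tensor (B.tensor D)) :=
  (ofPair_comp_ofPair t _ _ _ _).trans (ofPair_congr (Iso.inv_hom_id _) (Iso.hom_inv_id _))

theorem assocInv_assoc (A B D : IntObj C) :
    comp t (assocInv A B D) (assoc A B D) = id ((A.tensor B).tensor D) :=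
  (ofPair_comp_ofPair t _ _ _ _).trans (ofPair_congr (Iso.hom_inv_id _) (Iso.inv_hom_id _))

theorem symm_symm (A B : IntObj C) :
    comp t (symm A B) (symm B A) = id (A.tensor B) :=
  (ofPair_comp_ofPair t _ _ _ _).trans (ofPair_congr (SymmetricCategory.symmetry _ _)
    (SymmetricCategory.symmetry _ _))

theorem hexagon (A B D : IntObj C) :
    comp t (assoc A B D) (comp t (symm (A.tensor B) D) (assoc D A B)) =
      comp t (tensor (id A) (symm B D)) (comp t (assoc A D B) (tensor (symm A D) (id B))) := by
  refine (comp_eq_ofPair t rfl (comp_eq_ofPair t rfl rfl)).trans (Eq.trans ?_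
    (comp_eq_ofPair t (tensor_eq_ofPair rfl rfl) (comp_eq_ofPair t rfl
      (tensor_eq_ofPair rfl rfl))).symm)
  refine ofPair_congr ?_ ?_
  · have h := BraidedCategory.hexagon_reverse A.pos B.pos D.pos
    rw [← tensorHom_id, ← id_tensorHom] at h
    exact h
  · obtain ⟨_, X⟩ := A
    obtain ⟨_, Y⟩ := B
    obtain ⟨_, Z⟩ := D
    change ((α_ Y X Z).inv ≫ (β_ (Y ⊗ X) Z).hom) ≫ (α_ Z Y X).inv =
      ((𝟙 Y ⊗ₘ (β_ X Z).hom) ≫ (α_ Y Z X).inv) ≫ ((β_ Y Z).hom ⊗ₘ 𝟙 X)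
    simp

/-- The shape of the standard split and merge: one general arrow between two pairs, hence no trace.
-/
theorem comp_comp_of_eq_ofPair {A B D E : IntObj C} {F : IntHom A B} {k : IntHom B D}
    {G : IntHom D E} {f : A.pos ⟶ B.pos} {g : B.neg ⟶ A.neg} {f' : D.pos ⟶ E.pos}
    {g' : E.neg ⟶ D.neg} (hF : F = ofPair f g) (hG : G = ofPair f' g') :
    comp t F (comp t k G) =
      (f ▷ E.neg ≫ (B.pos ◁ g' ≫ (show B.pos ⊗ D.neg ⟶ D.pos ⊗ B.neg from k) ≫
        f' ▷ B.neg) ≫ E.pos ◁ g : A.pos ⊗ E.neg ⟶ E.pos ⊗ A.neg) := by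
  rw [hF, hG, ofPair_comp, comp_ofPair]

end

end IntHom

/-! ### `Int C` as a monoidal category -/

section IntCat

variable {C : Type*} [Category C] [MonoidalCategory C] [SymmetricCategory C]

/-- The objects of `Int C`, with the category structure given by a trace. -/
def IntCat (_ : SymmetricTrace C) := IntObj C

namespace IntCat

variable (t : SymmetricTrace C)

instance : Category (IntCat t) where
  Hom A B := IntHom (C := C) A B
  id A := IntHom.id A
  comp f g := IntHom.comp t f g
  id_comp := IntHom.id_comp t
  comp_id := IntHom.comp_id t
  assoc := IntHom.comp_assoc t

/-- The isomorphism of `Int C` given by two isomorphisms of `C`. -/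
def isoOfPair {A B : IntCat t} (f : IntObj.pos A ≅ IntObj.pos B)
    (g : IntObj.neg B ≅ IntObj.neg A) : A ≅ B where
  hom := IntHom.ofPair f.hom g.hom
  inv := IntHom.ofPair f.inv g.inv
  hom_inv_id := (IntHom.ofPair_comp_ofPair t _ _ _ _).trans
    (IntHom.ofPair_congr f.hom_inv_id g.inv_hom_id)
  inv_hom_id := (IntHom.ofPair_comp_ofPair t _ _ _ _).trans
    (IntHom.ofPair_congr f.inv_hom_id g.hom_inv_id)

instance : MonoidalCategoryStruct (IntCat t) where
  tensorObj A B := IntObj.tensor A B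
  whiskerLeft A _ _ f := IntHom.tensor (IntHom.id A) f
  whiskerRight f B := IntHom.tensor f (IntHom.id B)
  tensorHom f g := IntHom.tensor f g
  tensorUnit := IntObj.unit C
  associator A B D := isoOfPair t (α_ (IntObj.pos A) (IntObj.pos B) (IntObj.pos D))
    (α_ (IntObj.neg D) (IntObj.neg B) (IntObj.neg A))
  leftUnitor A := isoOfPair t (λ_ (IntObj.pos A)) (ρ_ (IntObj.neg A)).symm
  rightUnitor A := isoOfPair t (ρ_ (IntObj.pos A)) (λ_ (IntObj.neg A)).symm

/-- Lets Frobenius laws proved in an arbitrary monoidal category be read in `Int C`. -/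
instance : MonoidalCategory (IntCat t) := MonoidalCategory.ofTensorHom
  (id_tensorHom_id := IntHom.tensor_id)
  (id_tensorHom := fun _ _ _ _ => rfl)
  (tensorHom_id := fun _ _ => rfl)
  (tensorHom_comp_tensorHom := fun f₁ f₂ g₁ g₂ => IntHom.tensor_comp t f₁ g₁ f₂ g₂)
  (associator_naturality := fun {X₁ X₂ X₃ Y₁ Y₂ Y₃} f₁ f₂ f₃ => by
    rw [← Iso.eq_comp_inv, Category.assoc, ← Iso.inv_comp_eq]
    exact (IntHom.assoc_natural t f₁ f₂ f₃).symm)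
  (leftUnitor_naturality := fun f => IntHom.leftUnitor_natural t f)
  (rightUnitor_naturality := fun f => IntHom.rightUnitor_natural t f)
  (pentagon := IntHom.pentagon t)
  (triangle := IntHom.triangle t)

end IntCat

end IntCat

/-! ### Frobenius algebras in a monoidal category -/

section Frobenius

variable {D : Type*} [Category D] [MonoidalCategory D]

/-- `(d, m)` is an Abramsky-Heunen (unitless) Frobenius algebra at `E`. -/
structure AHFrobeniusAt {E : D} (d : E ⟶ E ⊗ E) (m : E ⊗ E ⟶ E) : Prop where
  merge_assoc : E ◁ m ≫ m = (α_ E E E).inv ≫ m ▷ E ≫ m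
  split_coassoc : d ≫ E ◁ d ≫ (α_ E E E).inv = d ≫ d ▷ E
  frobenius_left : d ▷ E ≫ (α_ E E E).hom ≫ E ◁ m = m ≫ d
  frobenius_right : E ◁ d ≫ (α_ E E E).inv ≫ m ▷ E = m ≫ d

/-- The algebra at `P ⊗ Q` given by arrows between `𝟙_ D` and `Q ⊗ P`. -/
theorem ahFrobeniusAt_canonical {P Q : D} (η : 𝟙_ D ⟶ Q ⊗ P) (ε : Q ⊗ P ⟶ 𝟙_ D) :
    AHFrobeniusAt (E := P ⊗ Q)
      (P ◁ (λ_ Q).inv ≫ P ◁ η ▷ Q ≫ P ◁ (α_ Q P Q).hom ≫ (α_ P Q (P ⊗ Q)).inv)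
      ((α_ P Q (P ⊗ Q)).hom ≫ P ◁ (α_ Q P Q).inv ≫ P ◁ ε ▷ Q ≫ P ◁ (λ_ Q).hom) where
  -- No zigzag identity is used for any of the four laws: after rebracketing, each is the
  -- interchange of two arrows among `η` and `ε` acting on disjoint factors.
  merge_assoc := by
    calc
      _ = 𝟙 _ ⊗≫ P ◁ ((Q ⊗ P) ◁ ε ≫ ε ▷ 𝟙_ D) ▷ Q ⊗≫ 𝟙 _ := by monoidal
      _ = _ := by rw [whisker_exchange]; monoidal
  split_coassoc := by
    calc
      _ = 𝟙 _ ⊗≫ P ◁ (η ▷ 𝟙_ D ≫ (Q ⊗ P) ◁ η) ▷ Q ⊗≫ 𝟙 _ := by monoidal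
      _ = _ := by rw [← whisker_exchange]; monoidal
  frobenius_left := by
    calc
      _ = 𝟙 _ ⊗≫ P ◁ (η ▷ (Q ⊗ P) ≫ (Q ⊗ P) ◁ ε) ▷ Q ⊗≫ 𝟙 _ := by monoidal
      _ = _ := by rw [← whisker_exchange]; monoidal
  frobenius_right := by
    calc
      _ = 𝟙 _ ⊗≫ P ◁ ((Q ⊗ P) ◁ η ≫ ε ▷ (Q ⊗ P)) ▷ Q ⊗≫ 𝟙 _ := by monoidal
      _ = _ := by rw [whisker_exchange]; monoidal

/-- Adjacent copies of `e.hom` and `e.inv` cancel; naturality of the associator moves the others to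
the ends. -/
theorem AHFrobeniusAt.transport {E O : D} {d : E ⟶ E ⊗ E} {m : E ⊗ E ⟶ E}
    (H : AHFrobeniusAt d m) (e : E ≅ O) :
    AHFrobeniusAt (e.inv ≫ d ≫ (e.hom ⊗ₘ e.hom)) ((e.inv ⊗ₘ e.inv) ≫ m ≫ e.hom) where
  merge_assoc := by
    have h₁ : O ◁ ((e.inv ⊗ₘ e.inv) ≫ m ≫ e.hom) ≫ (e.inv ⊗ₘ e.inv) =
      (e.inv ⊗ₘ (e.inv ⊗ₘ e.inv)) ≫ E ◁ m := by
      simp only [← id_tensorHom, tensorHom_comp_tensorHom]; simp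
    have h₂ : ((e.inv ⊗ₘ e.inv) ≫ m ≫ e.hom) ▷ O ≫ (e.inv ⊗ₘ e.inv) =
      ((e.inv ⊗ₘ e.inv) ⊗ₘ e.inv) ≫ m ▷ E := by
      simp only [← tensorHom_id, tensorHom_comp_tensorHom]; simp
    rw [reassoc_of% h₁, reassoc_of% h₂, reassoc_of% H.merge_assoc,
      associator_inv_naturality_assoc]
  split_coassoc := by
    have h₁ : (e.hom ⊗ₘ e.hom) ≫ O ◁ (e.inv ≫ d ≫ (e.hom ⊗ₘ e.hom)) =
      E ◁ d ≫ (e.hom ⊗ₘ (e.hom ⊗ₘ e.hom)) := by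
      simp only [← id_tensorHom, tensorHom_comp_tensorHom]; simp
    have h₂ : (e.hom ⊗ₘ e.hom) ≫ (e.inv ≫ d ≫ (e.hom ⊗ₘ e.hom)) ▷ O =
      d ▷ E ≫ ((e.hom ⊗ₘ e.hom) ⊗ₘ e.hom) := by
      simp only [← tensorHom_id, tensorHom_comp_tensorHom]; simp
    simp only [Category.assoc]
    rw [h₂, reassoc_of% h₁, ← reassoc_of% H.split_coassoc, associator_inv_naturality]
  frobenius_left := by
    have h₁ : (e.inv ≫ d ≫ (e.hom ⊗ₘ e.hom)) ▷ O =
      (e.inv ⊗ₘ e.inv) ≫ d ▷ E ≫ ((e.hom ⊗ₘ e.hom) ⊗ₘ e.hom) := by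
      simp only [← tensorHom_id, tensorHom_comp_tensorHom]; simp
    have h₂ : (e.hom ⊗ₘ (e.hom ⊗ₘ e.hom)) ≫ O ◁ ((e.inv ⊗ₘ e.inv) ≫ m ≫ e.hom) =
      E ◁ m ≫ (e.hom ⊗ₘ e.hom) := by
      simp only [← id_tensorHom, tensorHom_comp_tensorHom]; simp
    rw [h₁]
    simp only [Category.assoc, Iso.hom_inv_id_assoc]
    rw [associator_naturality_assoc, h₂, reassoc_of% H.frobenius_left]
  frobenius_right := by
    have h₁ : O ◁ (e.inv ≫ d ≫ (e.hom ⊗ₘ e.hom)) =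
      (e.inv ⊗ₘ e.inv) ≫ E ◁ d ≫ (e.hom ⊗ₘ (e.hom ⊗ₘ e.hom)) := by
      simp only [← id_tensorHom, tensorHom_comp_tensorHom]; simp
    have h₂ : ((e.hom ⊗ₘ e.hom) ⊗ₘ e.hom) ≫ ((e.inv ⊗ₘ e.inv) ≫ m ≫ e.hom) ▷ O =
      m ▷ E ≫ (e.hom ⊗ₘ e.hom) := by
      simp only [← tensorHom_id, tensorHom_comp_tensorHom]; simp
    rw [h₁]
    simp only [Category.assoc, Iso.hom_inv_id_assoc]
    rw [associator_inv_naturality_assoc, h₂, reassoc_of% H.frobenius_right]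

end Frobenius

/-! ### The standard split and merge in closed form -/

section Standard

variable {C : Type*} [Category C] [MonoidalCategory C] [SymmetricCategory C]
  (t : SymmetricTrace C) (N : C)

/-- The standard arrows unfold to the transported canonical ones, with $P=A^*$, $Q=A$ for $A=(I,N)$.
-/
theorem ahFrobeniusAt_standard :
    AHFrobeniusAt (D := IntCat t) (E := IntObj.mk N N) (IntHom.standardSplit t N)
      (IntHom.standardMerge t N) :=
  (ahFrobeniusAt_canonical (D := IntCat t) (P := IntObj.mk N (𝟙_ C)) (Q := IntObj.mk (𝟙_ C) N)
    (IntHom.eta _) (IntHom.epsilon (IntObj.mk N (𝟙_ C)))).transport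
    (IntCat.isoOfPair t (B := IntObj.mk N N) (ρ_ N) (ρ_ N).symm)

open Grading Pt IntHom

theorem pre_tensorArrow {G : Grading C} {X₁ U₁ Y₁ V₁ X₂ U₂ Y₂ V₂ : C} (f : X₁ ⊗ V₁ ⟶ Y₁ ⊗ U₁)
    (g : X₂ ⊗ V₂ ⟶ Y₂ ⊗ U₂) (y₁ : Pt G Y₁) (u₁ : Pt G U₁) (y₂ : Pt G Y₂) (u₂ : Pt G U₂) :
    pre (tensorArrow f g) (tens (tens y₁ y₂) (tens u₂ u₁)) =
      pre (tensorIn X₁ V₁ X₂ V₂) (tens (pre f (tens y₁ u₁)) (pre g (tens y₂ u₂))) := by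
  rw [tensorArrow_eq, pre_comp, pre_comp, pre_tensorOut, pre_tensorHom]

theorem standardSplit_eq : standardSplit t N =
    (N ◁ (β_ N N).hom ≫ (α_ N N N).inv : N ⊗ (N ⊗ N) ⟶ (N ⊗ N) ⊗ N) := by
  -- Regroups the six factors so that `k₃`, the one containing `eta`, stands between two composites
  -- of pairs.
  have h {A₁ A₂ A₃ A₄ A₅ A₆ A₇ : IntObj C} (k₁ : IntHom A₁ A₂) (k₂ : IntHom A₂ A₃)
      (k₃ : IntHom A₃ A₄) (k₄ : IntHom A₄ A₅) (k₅ : IntHom A₅ A₆) (k₆ : IntHom A₆ A₇) :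
      comp t k₁ (comp t (comp t k₂ (comp t k₃ (comp t k₄ k₅))) k₆) =
        comp t (comp t k₁ k₂) (comp t k₃ (comp t (comp t k₄ k₅) k₆)) := by
    simp only [comp_assoc]
  refine (h _ _ _ _ _ _).trans ((comp_comp_of_eq_ofPair t
    (comp_eq_ofPair t rfl (tensor_eq_ofPair rfl rfl))
    (comp_eq_ofPair t (comp_eq_ofPair t (tensor_eq_ofPair rfl rfl) rfl)
      (tensor_eq_ofPair rfl rfl))).trans ?_)
  change ((ρ_ N).inv ≫ (𝟙 N ⊗ₘ (λ_ (𝟙_ C)).inv)) ▷ (N ⊗ N) ≫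
    ((N ⊗ 𝟙_ C ⊗ 𝟙_ C) ◁ (((ρ_ N).inv ⊗ₘ (ρ_ N).inv) ≫ (α_ (N ⊗ 𝟙_ C) N (𝟙_ C)).inv ≫
      ((α_ N (𝟙_ C) N).hom ⊗ₘ 𝟙 (𝟙_ C))) ≫
    tensorArrow (𝟙 N ⊗ₘ 𝟙 (𝟙_ C))
      (tensorArrow (β_ (𝟙_ C) (𝟙_ C ⊗ N)).hom (𝟙 (𝟙_ C) ⊗ₘ 𝟙 N)) ≫
    (((𝟙 N ⊗ₘ (α_ (𝟙_ C) N (𝟙_ C)).hom) ≫ (α_ N (𝟙_ C) (N ⊗ 𝟙_ C)).inv) ≫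
      ((ρ_ N).hom ⊗ₘ (ρ_ N).hom)) ▷ ((N ⊗ 𝟙_ C) ⊗ 𝟙_ C)) ≫
    (N ⊗ N) ◁ (((ρ_ N).hom ⊗ₘ 𝟙 (𝟙_ C)) ≫ (ρ_ N).hom) = _
  -- One atom for each strand `N`; the unit objects all carry the neutral element.
  let l := [N, N, N]
  refine (((sharp_atom l 0 N rfl).tens (sharp_atom l 1 N rfl) rfl).tens
    (sharp_atom l 2 N rfl) rfl).eq_of_pre_eq ?_
  simp only [pre_comp, pre_whiskerRight, pre_whiskerLeft, pre_leftUnitor_inv, pre_rightUnitor_hom, pre_rightUnitor_inv, pre_tensorHom, pre_tensorArrow,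
    pre_tensorIn, pre_associator_hom, pre_associator_inv, pre_braiding, pre_id]

theorem standardMerge_eq : standardMerge t N =
    ((α_ N N N).hom ≫ N ◁ (β_ N N).hom : (N ⊗ N) ⊗ N ⟶ N ⊗ (N ⊗ N)) := by
  -- Now the isolated factor is `k₄`, which contains `epsilon`.
  have h {A₁ A₂ A₃ A₄ A₅ A₆ A₇ : IntObj C} (k₁ : IntHom A₁ A₂) (k₂ : IntHom A₂ A₃)
      (k₃ : IntHom A₃ A₄) (k₄ : IntHom A₄ A₅) (k₅ : IntHom A₅ A₆) (k₆ : IntHom A₆ A₇) :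
      comp t k₁ (comp t (comp t k₂ (comp t k₃ (comp t k₄ k₅))) k₆) =
        comp t (comp t k₁ (comp t k₂ k₃)) (comp t k₄ (comp t k₅ k₆)) := by
    simp only [comp_assoc]
  refine (h _ _ _ _ _ _).trans ((comp_comp_of_eq_ofPair t
    (comp_eq_ofPair t (tensor_eq_ofPair rfl rfl) (comp_eq_ofPair t rfl (tensor_eq_ofPair rfl rfl)))
    (comp_eq_ofPair t (tensor_eq_ofPair rfl rfl) rfl)).trans ?_)
  change (((ρ_ N).inv ⊗ₘ (ρ_ N).inv) ≫ (α_ N (𝟙_ C) (N ⊗ 𝟙_ C)).hom ≫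
      (𝟙 N ⊗ₘ (α_ (𝟙_ C) N (𝟙_ C)).inv)) ▷ N ≫
    ((N ⊗ (𝟙_ C ⊗ N) ⊗ 𝟙_ C) ◁ ((ρ_ N).inv ≫ ((ρ_ N).inv ⊗ₘ 𝟙 (𝟙_ C))) ≫
    tensorArrow (𝟙 N ⊗ₘ 𝟙 (𝟙_ C))
      (tensorArrow (β_ (𝟙_ C ⊗ N) (𝟙_ C)).hom (𝟙 (𝟙_ C) ⊗ₘ 𝟙 N)) ≫
    ((𝟙 N ⊗ₘ (λ_ (𝟙_ C)).hom) ≫ (ρ_ N).hom) ▷ ((N ⊗ 𝟙_ C ⊗ N) ⊗ 𝟙_ C)) ≫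
    N ◁ ((((α_ N (𝟙_ C) N).inv ⊗ₘ 𝟙 (𝟙_ C)) ≫ (α_ (N ⊗ 𝟙_ C) N (𝟙_ C)).hom) ≫
      ((ρ_ N).hom ⊗ₘ (ρ_ N).hom)) = _
  let l := [N, N, N]
  refine ((sharp_atom l 0 N rfl).tens ((sharp_atom l 1 N rfl).tens
    (sharp_atom l 2 N rfl) rfl) rfl).eq_of_pre_eq ?_
  simp only [pre_comp, pre_whiskerRight, pre_whiskerLeft, pre_leftUnitor_hom, pre_rightUnitor_hom, pre_rightUnitor_inv, pre_tensorHom, pre_tensorArrow,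
    pre_tensorIn, pre_associator_hom, pre_associator_inv, pre_braiding, pre_id]

end Standard

/-! ### Transfer to the endomorphisms of a strictly self-similar object -/

namespace StrictSelfSimilar

/-! ### The semi-monoidal structure coming from `C` -/

section Traced

variable {C : Type*} [Category C] {N : C}

theorem dot_endCast {A B D : C} (hA : A = N) (hB : B = N) (hD : D = N) (f : A ⟶ B) (g : B ⟶ D) :
    dot (endCast hB hD g) (endCast hA hB f) = endCast hA hD (f ≫ g) := by
  simp [dot, endCast]

theorem endCast_id {A : C} (hA : A = N) : endCast hA hA (𝟙 A) = 𝟙 N := by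
  simp [endCast]

theorem endCast_rfl (f : N ⟶ N) : endCast rfl rfl f = f := by
  simp [endCast]

variable [MonoidalCategory C] (h : N ⊗ N = N)

theorem tensor_eq (h : N ⊗ N = N) {A B : C} (hA : A = N) (hB : B = N) : A ⊗ B = N := by
  rw [hA, hB, h]

theorem tens_endCast {A B A' B' : C} (hA : A = N) (hB : B = N) (hA' : A' = N) (hB' : B' = N)
    (f : A ⟶ B) (g : A' ⟶ B') :
    tens h (endCast hA hB f) (endCast hA' hB' g) =
      endCast (tensor_eq h hA hA') (tensor_eq h hB hB') (f ⊗ₘ g) := by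
  subst hA hB hA' hB'
  rw [endCast_rfl, endCast_rfl, tens]

/-- Substitution makes the objects identical. It is needed at `N ⊗ N`, which occurs in the pentagon
but is only propositionally equal to `N`. -/
theorem endCast_associator_inv {A B D : C} (hA : A = N) (hB : B = N) (hD : D = N) :
    endCast (tensor_eq h hA (tensor_eq h hB hD)) (tensor_eq h (tensor_eq h hA hB) hD)
      (α_ A B D).inv = tau h := by
  subst hA hB hD
  rfl

theorem endCast_braiding [SymmetricCategory C] {A B : C} (hA : A = N) (hB : B = N) :
    endCast (tensor_eq h hA hB) (tensor_eq h hB hA) (β_ A B).hom = sigma h := by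
  subst hA hB
  rfl

theorem isSemiMonoidalMonoid_dot [SymmetricCategory C] :
    IsSemiMonoidalMonoid dot (tens h) (𝟙 N) (tau h) (tauInv h) (sigma h) where
  one_comp f := Category.comp_id f
  comp_one f := Category.id_comp f
  comp_assoc f g k := (Category.assoc k g f).symm
  tens_one := by
    conv_lhs => rw [← endCast_id (N := N) rfl, tens_endCast, id_tensorHom_id, endCast_id]
  tens_comp f f' g g' := by
    rw [← endCast_rfl f, ← endCast_rfl f', ← endCast_rfl g, ← endCast_rfl g']
    simp only [tens_endCast, dot_endCast, tensorHom_comp_tensorHom]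
  assoc_inv := by
    rw [tau, tauInv, dot_endCast, Iso.hom_inv_id, endCast_id]
  inv_assoc := by
    rw [tau, tauInv, dot_endCast, Iso.inv_hom_id, endCast_id]
  assoc_natural f g k := by
    rw [← endCast_rfl f, ← endCast_rfl g, ← endCast_rfl k]
    simp only [tau, tens_endCast, dot_endCast, associator_inv_naturality]
  pentagon := by
    have e₁ : tens h (𝟙 N) (tau h) =
        endCast (tensor_eq h rfl (tensor_right_eq h)) (tensor_eq h rfl (tensor_left_eq h))
          (N ◁ (α_ N N N).inv) := by
      rw [← endCast_id (N := N) rfl, tau, tens_endCast, id_tensorHom]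
    have e₂ : tens h (tau h) (𝟙 N) =
        endCast (tensor_eq h (tensor_right_eq h) rfl) (tensor_eq h (tensor_left_eq h) rfl)
          ((α_ N N N).inv ▷ N) := by
      rw [← endCast_id (N := N) rfl, tau, tens_endCast, tensorHom_id]
    -- The unwhiskered occurrences of `tau h` stand for associators at different triples, with `N ⊗
    -- N` in first, last or middle place; each is retyped before the pentagon of `C` applies.
    have e₃ := (congrArg₂ dot (endCast_associator_inv h h rfl rfl)
      (endCast_associator_inv h rfl rfl h)).symm.trans (dot_endCast _ _ _ _ _)
    rw [e₁, e₂, e₃, ← endCast_associator_inv h rfl h rfl, dot_endCast, dot_endCast]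
    simp
  symm_natural f g := by
    rw [← endCast_rfl f, ← endCast_rfl g]
    simp only [sigma, tens_endCast, dot_endCast, BraidedCategory.braiding_naturality]
  symm_symm := by
    rw [sigma, dot_endCast, SymmetricCategory.symmetry, endCast_id]
  hexagon := by
    have e₁ : tens h (𝟙 N) (sigma h) =
        endCast (tensor_eq h rfl h) (tensor_eq h rfl h) (N ◁ (β_ N N).hom) := by
      rw [← endCast_id (N := N) rfl, sigma, tens_endCast, id_tensorHom]
    have e₂ : tens h (sigma h) (𝟙 N) =
        endCast (tensor_eq h h rfl) (tensor_eq h h rfl) ((β_ N N).hom ▷ N) := by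
      rw [← endCast_id (N := N) rfl, sigma, tens_endCast, tensorHom_id]
    -- The `sigma h` still present is retyped as the braiding of `N ⊗ N` with `N`.
    rw [e₁, e₂, tau, dot_endCast, dot_endCast, ← endCast_braiding h h rfl, dot_endCast,
      dot_endCast]
    congr 1
    simp

end Traced

/-! ### The semi-monoidal structure and Frobenius algebra coming from `Int C` -/

section Int

variable {C : Type*} [Category C] [MonoidalCategory C] {N : C} (h : N ⊗ N = N)

theorem toInt_intCast (f : IntHom (⟨N, N⟩ : IntObj C) ⟨N, N⟩) :
    toInt h (intCast h rfl rfl f) = f := by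
  change eqToHom _ ≫ (eqToHom _ ≫ f ≫ eqToHom _) ≫ eqToHom _ = f
  rw [Category.assoc, eqToHom_trans_assoc, eqToHom_refl, Category.id_comp]
  refine (Category.assoc _ _ _).trans ?_
  rw [eqToHom_trans, eqToHom_refl]
  exact Category.comp_id _

theorem intCast_toInt (f : N ⟶ N) : intCast h rfl rfl (toInt h f) = f := by
  change eqToHom _ ≫ (eqToHom h ≫ f ≫ eqToHom h.symm) ≫ eqToHom _ = f
  simp

theorem intCast_id {A : IntObj C} (hA : A = ⟨N, N⟩) : intCast h hA hA (IntHom.id A) = 𝟙 N := by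
  subst hA
  exact (congrArg (endCast h h) (id_tensorHom_id N N)).trans (endCast_id h)

theorem intObj_tensor_eq (h : N ⊗ N = N) {A B : IntObj C} (hA : A = ⟨N, N⟩) (hB : B = ⟨N, N⟩) :
    A.tensor B = ⟨N, N⟩ := by
  rw [hA, hB, intTensor_eq h]

theorem intCast_assoc {A B D : IntObj C} (hA : A = ⟨N, N⟩) (hB : B = ⟨N, N⟩) (hD : D = ⟨N, N⟩) :
    intCast h (intObj_tensor_eq h hA (intObj_tensor_eq h hB hD))
      (intObj_tensor_eq h (intObj_tensor_eq h hA hB) hD) (IntHom.assoc A B D) = intAssoc h := by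
  subst hA hB hD
  rfl

theorem intAssoc_eq : intAssoc h = tens h (tau h) (tau h) := by
  rw [tau, tens_endCast]
  rfl

theorem intAssocInv_eq : intAssocInv h = tens h (tauInv h) (tauInv h) := by
  rw [tauInv, tens_endCast]
  rfl

variable [SymmetricCategory C] (t : SymmetricTrace C)

theorem intCast_symm {A B : IntObj C} (hA : A = ⟨N, N⟩) (hB : B = ⟨N, N⟩) :
    intCast h (intObj_tensor_eq h hA hB) (intObj_tensor_eq h hB hA) (IntHom.symm A B) =
      intSymm h := by
  subst hA hB
  rfl

/-- With `box_intCast`, turns an equation in $M$ into the cast of a typed equation in `Int C`. -/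
theorem circ_intCast {A B D : IntObj C} (hA : A = ⟨N, N⟩) (hB : B = ⟨N, N⟩) (hD : D = ⟨N, N⟩)
    (f : IntHom A B) (g : IntHom B D) :
    circ h t (intCast h hB hD g) (intCast h hA hB f) = intCast h hA hD (IntHom.comp t f g) := by
  subst hA hB hD
  rw [circ, toInt_intCast, toInt_intCast]

theorem box_intCast {A B A' B' : IntObj C} (hA : A = ⟨N, N⟩) (hB : B = ⟨N, N⟩)
    (hA' : A' = ⟨N, N⟩) (hB' : B' = ⟨N, N⟩) (f : IntHom A B) (g : IntHom A' B') :
    box h (intCast h hA hB f) (intCast h hA' hB' g) =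
      intCast h (intObj_tensor_eq h hA hA') (intObj_tensor_eq h hB hB') (IntHom.tensor f g) := by
  subst hA hB hA' hB'
  rw [box, toInt_intCast, toInt_intCast]

theorem isSemiMonoidalMonoid_circ :
    IsSemiMonoidalMonoid (circ h t) (box h) (𝟙 N) (intAssoc h) (intAssocInv h) (intSymm h) where
  one_comp f := by
    rw [← intCast_toInt h f, ← intCast_id h rfl, circ_intCast, IntHom.comp_id]
  comp_one f := by
    rw [← intCast_toInt h f, ← intCast_id h rfl, circ_intCast, IntHom.id_comp]
  comp_assoc f g k := by
    rw [← intCast_toInt h f, ← intCast_toInt h g, ← intCast_toInt h k]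
    simp only [circ_intCast, IntHom.comp_assoc]
  tens_one := by
    conv_lhs => rw [← intCast_id h rfl, box_intCast, IntHom.tensor_id, intCast_id]
  tens_comp f f' g g' := by
    rw [← intCast_toInt h f, ← intCast_toInt h f', ← intCast_toInt h g, ← intCast_toInt h g']
    simp only [circ_intCast, box_intCast, IntHom.tensor_comp]
  assoc_inv := by
    rw [intAssoc, intAssocInv, circ_intCast, IntHom.assocInv_assoc, intCast_id]
  inv_assoc := by
    rw [intAssoc, intAssocInv, circ_intCast, IntHom.assoc_assocInv, intCast_id]
  assoc_natural f g k := by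
    rw [← intCast_toInt h f, ← intCast_toInt h g, ← intCast_toInt h k]
    simp only [intAssoc, box_intCast, circ_intCast, IntHom.assoc_natural]
  pentagon := by
    have e₁ : box h (𝟙 N) (intAssoc h) =
        intCast h (intObj_tensor_eq h rfl (intTensor_right_eq h))
          (intObj_tensor_eq h rfl (intTensor_left_eq h))
          (IntHom.tensor (IntHom.id ⟨N, N⟩) (IntHom.assoc _ _ _)) := by
      rw [← intCast_id h rfl, intAssoc, box_intCast]
    have e₂ : box h (intAssoc h) (𝟙 N) =
        intCast h (intObj_tensor_eq h (intTensor_right_eq h) rfl)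
          (intObj_tensor_eq h (intTensor_left_eq h) rfl)
          (IntHom.tensor (IntHom.assoc _ _ _) (IntHom.id ⟨N, N⟩)) := by
      rw [← intCast_id h rfl, intAssoc, box_intCast]
    have e₃ := (congrArg₂ (circ h t) (intCast_assoc h (intTensor_eq h) rfl rfl)
      (intCast_assoc h rfl rfl (intTensor_eq h))).symm.trans (circ_intCast h t _ _ _ _ _)
    rw [e₁, e₂, e₃, ← intCast_assoc h rfl (intTensor_eq h) rfl, circ_intCast, circ_intCast]
    refine congrArg _ ?_
    exact (IntHom.comp_assoc t _ _ _).trans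
      (@MonoidalCategory.pentagon_inv (IntCat t) _ _ (IntObj.mk N N) (IntObj.mk N N)
        (IntObj.mk N N) (IntObj.mk N N))
  symm_natural f g := by
    rw [← intCast_toInt h f, ← intCast_toInt h g]
    simp only [intSymm, box_intCast, circ_intCast, IntHom.symm_natural]
  symm_symm := by
    rw [intSymm, circ_intCast, IntHom.symm_symm, intCast_id]
  hexagon := by
    have e₁ : box h (𝟙 N) (intSymm h) =
        intCast h (intObj_tensor_eq h rfl (intTensor_eq h))
          (intObj_tensor_eq h rfl (intTensor_eq h))
          (IntHom.tensor (IntHom.id ⟨N, N⟩) (IntHom.symm _ _)) := by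
      rw [← intCast_id h rfl, intSymm, box_intCast]
    have e₂ : box h (intSymm h) (𝟙 N) =
        intCast h (intObj_tensor_eq h (intTensor_eq h) rfl)
          (intObj_tensor_eq h (intTensor_eq h) rfl)
          (IntHom.tensor (IntHom.symm _ _) (IntHom.id ⟨N, N⟩)) := by
      rw [← intCast_id h rfl, intSymm, box_intCast]
    rw [e₁, e₂, intAssoc, circ_intCast, circ_intCast, ← intCast_symm h (intTensor_eq h) rfl,
      circ_intCast, circ_intCast]
    refine congrArg _ ?_
    rw [IntHom.comp_assoc, IntHom.comp_assoc, IntHom.hexagon]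

theorem isAHFrobenius_standard :
    IsAHFrobenius (circ h t) (box h) (𝟙 N) (intAssoc h) (intAssocInv h) (split h t)
      (merge h t) := by
  have H := ahFrobeniusAt_standard t N
  have e₁ : box h (𝟙 N) (merge h t) = intCast h (intTensor_right_eq h) (intTensor_eq h)
      (IntHom.tensor (IntHom.id ⟨N, N⟩) (IntHom.standardMerge t N)) := by
    rw [← intCast_id h rfl, merge, box_intCast]
  have e₂ : box h (merge h t) (𝟙 N) = intCast h (intTensor_left_eq h) (intTensor_eq h)
      (IntHom.tensor (IntHom.standardMerge t N) (IntHom.id ⟨N, N⟩)) := by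
    rw [← intCast_id h rfl, merge, box_intCast]
  have e₃ : box h (𝟙 N) (split h t) = intCast h (intTensor_eq h) (intTensor_right_eq h)
      (IntHom.tensor (IntHom.id ⟨N, N⟩) (IntHom.standardSplit t N)) := by
    rw [← intCast_id h rfl, split, box_intCast]
  have e₄ : box h (split h t) (𝟙 N) = intCast h (intTensor_eq h) (intTensor_left_eq h)
      (IntHom.tensor (IntHom.standardSplit t N) (IntHom.id ⟨N, N⟩)) := by
    rw [← intCast_id h rfl, split, box_intCast]
  constructor
  · rw [e₁, e₂, merge, intAssoc]
    simp only [circ_intCast]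
    exact congrArg _ (H.merge_assoc.trans (Category.assoc _ _ _).symm)
  · rw [e₃, e₄, split, intAssoc]
    simp only [circ_intCast]
    exact congrArg _ ((Category.assoc _ _ _).trans H.split_coassoc)
  · rw [e₁, e₄, split, merge, intAssocInv]
    simp only [circ_intCast]
    exact congrArg _ ((Category.assoc _ _ _).trans H.frobenius_left)
  · rw [e₂, e₃, split, merge, intAssoc]
    simp only [circ_intCast]
    exact congrArg _ ((Category.assoc _ _ _).trans H.frobenius_right)

theorem split_eq : split h t = dot (tau h) (tens h (𝟙 N) (sigma h)) := by
  rw [split, standardSplit_eq, ← endCast_id (N := N) rfl, sigma, tens_endCast, tau,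
    dot_endCast, id_tensorHom]
  rfl

theorem merge_eq : merge h t = dot (tens h (𝟙 N) (sigma h)) (tauInv h) := by
  rw [merge, standardMerge_eq, ← endCast_id (N := N) rfl, sigma, tens_endCast, tauInv,
    dot_endCast, id_tensorHom]
  rfl

end Int

end StrictSelfSimilar

/-- If the associator is invertible, the A-H Frobenius monoid is the closure of its generators under
the two operations alone. -/
theorem ahFrobeniusMonoid_eq_opClosure {M : Type*} (comp tens : M → M → M)
    (one assoc assocInv split merge : M) (h : comp assoc assocInv = one) :
    ahFrobeniusMonoid comp tens one assoc assocInv split merge =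
      {f | OpClosure comp tens {split, merge, assoc, assocInv} f} := by
  apply Set.Subset.antisymm
  · refine Set.sInter_subset_of_mem ⟨⟨?_, fun f g => OpClosure.comp f g,
      fun f g => OpClosure.tens f g⟩, ?_⟩
    -- The identity is not a generator; it is recovered as the associator composed with its inverse.
    · rw [← h]
      exact OpClosure.comp _ _ (.basic _ (by simp)) (.basic _ (by simp))
    · rintro f (rfl | rfl | rfl | rfl) <;> exact .basic _ (by simp)
  · rintro f hf A ⟨hA, hs⟩
    induction hf with
    | basic f hf =>
      refine hs ?_
      rcases hf with rfl | rfl | rfl | rfl <;> simp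
    | comp f g _ _ hf hg => exact hA.comp_mem f g hf hg
    | tens f g _ _ hf hg => exact hA.tens_mem f g hf hg

theorem mainTheorem5 {C : Type*} [Category C] [MonoidalCategory C] [SymmetricCategory C]
    (t : SymmetricTrace C) (N : C) (h : N ⊗ N = N) :
    IsSemiMonoidalMonoid dot (tens h) (𝟙 N) (tau h) (tauInv h) (sigma h) ∧
    IsSemiMonoidalMonoid (circ h t) (box h) (𝟙 N) (intAssoc h) (intAssocInv h) (intSymm h) ∧
    IsAHFrobenius (circ h t) (box h) (𝟙 N) (intAssoc h) (intAssocInv h) (split h t) (merge h t) ∧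
    split h t = dot (tau h) (tens h (𝟙 N) (sigma h)) ∧
    merge h t = dot (tens h (𝟙 N) (sigma h)) (tauInv h) ∧
    intAssoc h = tens h (tau h) (tau h) ∧
    intAssocInv h = tens h (tauInv h) (tauInv h) ∧
    standardAHFrobeniusMonoid h t =
      {f | OpClosure (circ h t) (box h)
        {dot (tau h) (tens h (𝟙 N) (sigma h)), dot (tens h (𝟙 N) (sigma h)) (tauInv h),
          tens h (tau h) (tau h), tens h (tauInv h) (tauInv h)} f} := by
  have H := isSemiMonoidalMonoid_circ h t
  refine ⟨isSemiMonoidalMonoid_dot h, H, isAHFrobenius_standard h t, split_eq h t, merge_eq h t,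
    intAssoc_eq h, intAssocInv_eq h, ?_⟩
  rw [← split_eq h t, ← merge_eq h t, ← intAssoc_eq h, ← intAssocInv_eq h]
  exact ahFrobeniusMonoid_eq_opClosure _ _ _ _ _ _ _ H.assoc_inv
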